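/- A sublebesgue measure is a measure $\mu=f(x)\,dx$ on $[0,1]$ with $f$ measurable and $0\le f\le 1$. For a binary word $w=w_1\cdots w_k$ let $$\rho_w(\mu)=k!\int_{0\le x_1<\dots<x_k\le 1}\prod_{i=1}^k g_i(x_i)\,dx_1\cdots dx_k,\qquad g_i=\begin{cases}f& w_i=1\\ 1-f& w_i=0,\end{cases}$$ so that in particular $\rho_1(\mu)=\int_0^1 f(x)\,dx$. Let $\rho\in[0,1]$. Among all sublebesgue measures $\mu$ with $\rho_1(\mu)=\rho$, the maximum of $\rho_{1010}(\mu)$ exists and equals $\frac{12}{e^2}\rho^2(1-\rho)^2$. It is attained by exactly one sublebesgue measure, namely the one with density (up to Lebesgue-null sets) $$f(x)=\begin{cases}1& 0\le x<\frac{\rho}{e}\\[2pt] \frac12\left(1+\frac{e^{1/2}(x+\rho-1)}{\sqrt{4\rho(1-\rho)+e(x+\rho-1)^2}}\right)&\frac{\rho}{e}<x<1-\frac{1-\rho}{e}\\[2pt] 0& 1-\frac{1-\rho}{e}<x\le 1.\end{cases}$$ Moreover, for a word $X\in\{0,1\}^{2n}$ with exactly $n$ ones (a deck of $2n$ cards,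 half black $=1$ and half red $=0$), let $\rho_{1010}(X)$ be the number of occurrences of $1010$ as a not necessarily consecutive subword of $X$, divided by $\binom{2n}{4}$; this is the probability that four cards drawn uniformly at random, kept in deck order, read black, red, black, red. Then the maximum of $\rho_{1010}(X)$ over all such $X$ tends to $\frac{3}{4e^2}$ as $n\to\infty$. -/

import Mathlib

open MeasureTheory Filter Topology Set

noncomputable section

/-- The number `N_w(X)` of occurrences of the word `w` as a (not necessarily consecutive)
subword of `X`; the letters `1` and `0` are `true` and `false`. -/
def patternCount {m n : ℕ} (w : Fin m → Bool) (X : Fin n → Bool) : ℕ :=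
  Nat.card {e : Fin m ↪o Fin n // ∀ i, X (e i) = w i}

/-- The density `N_w(X) / (n choose m)` of `w` in a finite binary word `X`, i.e. the probability
that a uniformly random length-`m` subsequence of `X` equals `w`. -/
def wordDensity {m n : ℕ} (w : Fin m → Bool) (X : Fin n → Bool) : ℝ :=
  (patternCount w X : ℝ) / (n.choose m : ℝ)

/-- Lebesgue measure on `[0,1]`, as a measure on the real line. -/
def lebesgueUnit : Measure ℝ := volume.restrict (Icc (0 : ℝ) 1)

/-- Sublebesgue measures: the measures `f(x) dx` on `[0,1]` with `f` taking values in `[0,1]`. -/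
def IsSublebesgue (μ : Measure ℝ) : Prop :=
  ∃ f : ℝ → ℝ, Measurable f ∧ (∀ x, f x ∈ Icc (0 : ℝ) 1) ∧
    μ = lebesgueUnit.withDensity (fun x => ENNReal.ofReal (f x))

/-- The density of a measure with respect to Lebesgue measure on `[0,1]`. -/
def unitDensity (μ : Measure ℝ) (x : ℝ) : ℝ := (μ.rnDeriv lebesgueUnit x).toReal

/-- The ordered simplex `0 ≤ x₁ < ⋯ < x_k ≤ 1`. -/
def orderedSimplex (k : ℕ) : Set (Fin k → ℝ) :=
  {x | StrictMono x ∧ ∀ i, x i ∈ Icc (0 : ℝ) 1}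

/-- The density `ρ_w(μ)` of the word `w` of length `k` in the sublebesgue measure `μ = f(x) dx`:
`k!` times the integral over the ordered simplex of the product over `i` of
`f(x_i)` (if `w_i = 1`) or `1 - f(x_i)` (if `w_i = 0`). -/
def patternDensity {k : ℕ} (w : Fin k → Bool) (μ : Measure ℝ) : ℝ :=
  (k.factorial : ℝ) *
    ∫ x in orderedSimplex k,
      ∏ i, (if w i = true then unitDensity μ (x i) else 1 - unitDensity μ (x i))

/-- The word `1`. -/
def word1 : Fin 1 → Bool := ![true]

/-- The word `1010`. -/
def word1010 : Fin 4 → Bool := ![true, false, true, false]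

/-- The explicit optimal density. -/
def optimalDensity (ρ x : ℝ) : ℝ :=
  if x < ρ / Real.exp 1 then 1
  else if x ≤ 1 - (1 - ρ) / Real.exp 1 then
    (1 / 2) * (1 + Real.exp (1 / 2) * (x + ρ - 1) /
      Real.sqrt (4 * ρ * (1 - ρ) + Real.exp 1 * (x + ρ - 1) ^ 2))
  else 0

/-- The sublebesgue measures `μ` with `ρ_1(μ) = ρ`. -/
def sublebesgueWithMass (ρ : ℝ) : Set (Measure ℝ) :=
  {μ | IsSublebesgue μ ∧ patternDensity word1 μ = ρ}

/-- The winning probabilities in the BRBR game of all arrangements of a deck of `2 * n` cards,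
`n` of them black (`true`) and `n` red (`false`). -/
def brbrProbabilities (n : ℕ) : Set ℝ :=
  {p | ∃ X : Fin (2 * n) → Bool,
    (Finset.univ.filter (fun i => X i = true)).card = n ∧ p = wordDensity word1010 X}

end

/-! Let `F x` be the mass of ones before `x` and `C x` the mass of zeros after `x`. The mass of the
pattern 10 before `y` is the integral of `f x * (C x - C y)` over `x < y`. Attaching to the second
1, at `y`, the `C y` zeros that follow it gives `ρ_1010 = 24 * ((∫ C dμ)^2 / 2 - ∫ F * C^2 dμ)`
(`patternDensity_word1010_eq`).

Under `μ` the function `F` is distributed as Lebesgue measure on `[0, A]` with `A = ρ`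
(`map_onesBefore`), and `C` takes values in `[0, B]` with `B = 1 - ρ`. Forgetting every other
relation between them leaves an abstract problem: maximize `(∫ c)^2 / 2 - ∫ a * c^2` over functions
`c` with values in `[0, B]`, where `a` is uniform on `[0, A]`. For fixed `∫ c` a Lagrange multiplier
argument gives the minimizer `c = B * k / max a k` of the convex term. With `k = A * exp (-L)` the
value is `(A * B)^2 / 2 * (L * exp (-L))^2`, which is largest exactly at `L = 1`. This yields `(A *
B / e)^2 / 2` and the equality case (`quadratic_bound`, `quadratic_le_and_eq`).

Equality says that `max F k * C` is `μ`-a.e. constant. Since `C x = B - (x - F x)`, this equation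
determines `F` up to the point where the ones run out, hence determines `μ`; solving the quadratic
equation for `F` and differentiating produces the explicit density.

For decks, the number of occurrences equals the same functional evaluated at a step function on `[0,
n]`, with no error term (`patternCount_word1010_eq`). So the abstract bound holds for every finite
deck, and rounding the extremal profile gives decks that attain it asymptotically. -/

/-! ### Elementary integrals and inequalities for the one-parameter family of profiles -/

theorem integral_inv_max {A k : ℝ} (hk : 0 < k) (hkA : k ≤ A) :
    ∫ a in (0 : ℝ)..A, (max a k)⁻¹ = 1 + Real.log (A / k) := by
  have hc : Continuous fun a : ℝ => (max a k)⁻¹ :=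
    (continuous_id.max continuous_const).inv₀ fun _ => (lt_max_of_lt_right hk).ne'
  rw [← intervalIntegral.integral_add_adjacent_intervals (hc.intervalIntegrable 0 k)
    (hc.intervalIntegrable k A)]
  congr 1
  · rw [intervalIntegral.integral_congr (g := fun _ => k⁻¹)]
    · simp [hk.ne']
    · intro x hx
      rw [uIcc_of_le hk.le] at hx
      simp [max_eq_right hx.2]
  · rw [intervalIntegral.integral_congr (g := fun x => x⁻¹)]
    · exact integral_inv_of_pos hk (hk.trans_le hkA)
    · intro x hx
      rw [uIcc_of_le hkA] at hx
      simp [max_eq_left hx.1]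

theorem integral_mul_inv_max_sq {A k : ℝ} (hk : 0 < k) (hkA : k ≤ A) :
    ∫ a in (0 : ℝ)..A, a * (max a k)⁻¹ ^ 2 = 1 / 2 + Real.log (A / k) := by
  have hc : Continuous fun a : ℝ => a * (max a k)⁻¹ ^ 2 :=
    continuous_id.mul (((continuous_id.max continuous_const).inv₀
      fun _ => (lt_max_of_lt_right hk).ne').pow 2)
  rw [← intervalIntegral.integral_add_adjacent_intervals (hc.intervalIntegrable 0 k)
    (hc.intervalIntegrable k A)]
  congr 1
  · rw [intervalIntegral.integral_congr (g := fun x => x * k⁻¹ ^ 2)]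
    · rw [intervalIntegral.integral_mul_const, integral_id]
      field_simp
      ring
    · intro x hx
      rw [uIcc_of_le hk.le] at hx
      simp [max_eq_right hx.2]
  · rw [intervalIntegral.integral_congr (g := fun x => x⁻¹)]
    · exact integral_inv_of_pos hk (hk.trans_le hkA)
    · intro x hx
      rw [uIcc_of_le hkA] at hx
      have : 0 < x := hk.trans_le hx.1
      simp only [max_eq_left hx.1]
      field_simp

/-- Selects the Lagrange parameter: the profile with `k = A * exp (-L)` has integral `A * B * (1 +
L) * exp (-L)`, so every admissible positive value of `∫ c` is matched by some `L`. -/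
theorem exists_one_add_mul_exp_neg_eq {t : ℝ} (ht : 0 < t) (ht1 : t ≤ 1) :
    ∃ L : ℝ, 0 ≤ L ∧ (1 + L) * Real.exp (-L) = t := by
  have hcont : Continuous fun L : ℝ => (1 + L) * Real.exp (-L) := by fun_prop
  have hlim : Tendsto (fun L : ℝ => (1 + L) * Real.exp (-L)) atTop (𝓝 0) := by
    have h1 := Real.tendsto_pow_mul_exp_neg_atTop_nhds_zero 1
    have h0 := Real.tendsto_pow_mul_exp_neg_atTop_nhds_zero 0
    have := h0.add h1
    simp only [pow_zero, pow_one, add_zero] at this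
    refine this.congr fun L => by ring
  obtain ⟨M, hM⟩ := ((hlim.eventually (gt_mem_nhds ht)).and (eventually_ge_atTop 0)).exists
  have := intermediate_value_Icc' hM.2 hcont.continuousOn
  obtain ⟨L, hL, hLt⟩ := this (show t ∈ Icc _ _ from ⟨hM.1.le, by simpa using ht1⟩)
  exact ⟨L, hL.1, hLt⟩

theorem mul_exp_neg_le (L : ℝ) : L * Real.exp (-L) ≤ Real.exp (-1) := by
  have h := Real.add_one_le_exp (L - 1)
  have : Real.exp (-1) = Real.exp (L - 1) * Real.exp (-L) := by rw [← Real.exp_add]; ring_nf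
  rw [this]
  exact mul_le_mul_of_nonneg_right (by linarith) (Real.exp_pos _).le

theorem eq_one_of_exp_neg_le {L : ℝ} (h : Real.exp (-1) ≤ L * Real.exp (-L)) : L = 1 := by
  by_contra hne
  have h1 := Real.add_one_lt_exp (x := L - 1) (sub_ne_zero.mpr hne)
  have : Real.exp (-1) = Real.exp (L - 1) * Real.exp (-L) := by rw [← Real.exp_add]; ring_nf
  rw [this] at h
  have := le_of_mul_le_mul_right h (Real.exp_pos _)
  linarith

/-! ### The abstract quadratic optimization problem -/

section Core

variable {Ω : Type*} [MeasurableSpace Ω] {μ : Measure Ω} {A B : ℝ} {a c : Ω → ℝ}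

theorem integral_comp_of_map_eq (hA : 0 ≤ A) (ha : Measurable a)
    (hmap : μ.map a = volume.restrict (Icc 0 A)) {φ : ℝ → ℝ} (hφ : Continuous φ) :
    ∫ ω, φ (a ω) ∂μ = ∫ s in (0 : ℝ)..A, φ s := by
  rw [← integral_map ha.aemeasurable hφ.aestronglyMeasurable, hmap,
    intervalIntegral.integral_of_le hA, integral_Icc_eq_integral_Ioc]

theorem isFiniteMeasure_of_map_eq (ha : Measurable a)
    (hmap : μ.map a = volume.restrict (Icc 0 A)) : IsFiniteMeasure μ := by
  constructor
  have := congrArg (fun m => m univ) hmap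
  simp only [Measure.map_apply ha MeasurableSet.univ, preimage_univ] at this
  rw [this]
  simp

theorem ae_mem_Icc_of_map_eq (ha : Measurable a)
    (hmap : μ.map a = volume.restrict (Icc 0 A)) : ∀ᵐ ω ∂μ, a ω ∈ Icc 0 A := by
  have : ∀ᵐ s ∂(μ.map a), s ∈ Icc 0 A := by
    rw [hmap]; exact ae_restrict_mem measurableSet_Icc
  exact ae_of_ae_map ha.aemeasurable this

/-- The extremal profile of height `B` on `[0, A]` with threshold `k`. -/
noncomputable def cutProfile (B k s : ℝ) : ℝ := B * k * (max s k)⁻¹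

theorem continuous_cutProfile {k : ℝ} (hk : 0 < k) : Continuous (cutProfile B k) :=
  continuous_const.mul ((continuous_id.max continuous_const).inv₀
      fun _ => (lt_max_of_lt_right hk).ne')

theorem cutProfile_mem_Icc {k : ℝ} (hB : 0 ≤ B) (hk : 0 < k) (s : ℝ) :
    cutProfile B k s ∈ Icc 0 B := by
  have hm : 0 < max s k := lt_max_of_lt_right hk
  refine ⟨by unfold cutProfile; positivity, ?_⟩
  rw [cutProfile, ← div_eq_mul_inv, div_le_iff₀ hm]
  exact mul_le_mul_of_nonneg_left (le_max_right _ _) hB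

/-- Expand `s * x^2` around `d = cutProfile B k s`. The linear coefficient `2 * s * d` may be
replaced by the constant multiplier `2 * B * k`: they agree for `s ≥ k`, while for `s ≤ k` the
constraint is active, `d = B ≥ x`, and both factors of the error are nonpositive. -/
theorem cutProfile_pointwise {k s x : ℝ} (hB : 0 ≤ B) (hk : 0 < k) (hx : x ≤ B) :
    s * cutProfile B k s ^ 2 + 2 * (B * k) * (x - cutProfile B k s)
      + s * (x - cutProfile B k s) ^ 2 ≤ s * x ^ 2 := by
  have key : (s * cutProfile B k s - B * k) * (x - cutProfile B k s) ≥ 0 := by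
    rcases le_total k s with h | h
    · have : s * cutProfile B k s = B * k := by
        have : 0 < s := hk.trans_le h
        rw [cutProfile, max_eq_left h]; field_simp
      simp [this]
    · have : cutProfile B k s = B := by
        rw [cutProfile, max_eq_right h]; field_simp
      rw [this]
      exact mul_nonneg_of_nonpos_of_nonpos
        (by nlinarith [mul_le_mul_of_nonneg_left h hB]) (by linarith)
  nlinarith [key]

/-- Integrates `cutProfile_pointwise`. As `L` is chosen so that `c` and the profile have equal
integrals, the multiplier term cancels. The weighted square distance to the profile is kept on the
left because it yields the equality case. -/
theorem quadratic_bound (hA : 0 < A) (hB : 0 < B) (ha : Measurable a) (hc : Measurable c)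
    (hmap : μ.map a = volume.restrict (Icc 0 A)) (hcB : ∀ᵐ ω ∂μ, c ω ∈ Icc 0 B) {L : ℝ}
    (hL : 0 ≤ L) (hT : ∫ ω, c ω ∂μ = A * B * ((1 + L) * Real.exp (-L))) :
    (∫ ω, c ω ∂μ) ^ 2 / 2 - ∫ ω, a ω * c ω ^ 2 ∂μ
      + ∫ ω, a ω * (c ω - cutProfile B (A * Real.exp (-L)) (a ω)) ^ 2 ∂μ
      ≤ (A * B) ^ 2 / 2 * (L * Real.exp (-L)) ^ 2 := by
  have := isFiniteMeasure_of_map_eq ha hmap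
  have hae := ae_mem_Icc_of_map_eq ha hmap
  set k := A * Real.exp (-L) with hkdef
  have hk : 0 < k := by positivity
  have hkA : k ≤ A := by
    have : Real.exp (-L) ≤ 1 := Real.exp_le_one_iff.mpr (by linarith)
    nlinarith
  have hlog : Real.log (A / k) = L := by
    rw [hkdef, div_mul_cancel_left₀ hA.ne', ← Real.exp_neg, neg_neg, Real.log_exp]
  set d : Ω → ℝ := fun ω => cutProfile B k (a ω) with hd
  have hdm : Measurable d := (continuous_cutProfile hk).measurable.comp ha
  have hdB : ∀ ω, d ω ∈ Icc 0 B := fun ω => cutProfile_mem_Icc hB.le hk _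
  have hid : Integrable d μ := Integrable.of_bound hdm.aestronglyMeasurable B
    (ae_of_all _ fun ω => by rw [Real.norm_of_nonneg (hdB ω).1]; exact (hdB ω).2)
  have hic : Integrable c μ := Integrable.of_bound hc.aestronglyMeasurable B
    (hcB.mono fun ω h => by rw [Real.norm_of_nonneg h.1]; exact h.2)
  have hsq : ∀ {g : Ω → ℝ}, Measurable g → (∀ᵐ ω ∂μ, |g ω| ≤ B) →
      Integrable (fun ω => a ω * g ω ^ 2) μ := by
    intro g hg hgB
    refine Integrable.of_bound (ha.mul (hg.pow_const 2)).aestronglyMeasurable (A * B ^ 2) ?_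
    filter_upwards [hae, hgB] with ω h1 h2
    rw [Real.norm_eq_abs, abs_mul, abs_of_nonneg h1.1, abs_pow]
    exact mul_le_mul h1.2 (pow_le_pow_left₀ (abs_nonneg _) h2 2) (by positivity) hA.le
  have hiac := hsq hc (hcB.mono fun ω h => by rw [abs_of_nonneg h.1]; exact h.2)
  have hiad := hsq hdm (ae_of_all _ fun ω => by rw [abs_of_nonneg (hdB ω).1]; exact (hdB ω).2)
  have hiacd := hsq (hc.sub hdm) (hcB.mono fun ω h => by
    have := hdB ω
    simp only [Pi.sub_apply]
    rw [abs_le]; constructor <;> linarith [h.1, h.2, this.1, this.2])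
  have hI1 : ∫ ω, d ω ∂μ = B * k * (1 + L) := by
    rw [hd, integral_comp_of_map_eq hA.le ha hmap (continuous_cutProfile hk)]
    simp only [cutProfile]
    rw [intervalIntegral.integral_const_mul, integral_inv_max hk hkA, hlog]
  have hI2 : ∫ ω, a ω * d ω ^ 2 ∂μ = (B * k) ^ 2 * (1 / 2 + L) := by
    rw [hd]
    rw [integral_comp_of_map_eq (φ := fun s => s * cutProfile B k s ^ 2) hA.le ha hmap
      (continuous_id.mul ((continuous_cutProfile hk).pow 2)), ← hlog,
      ← integral_mul_inv_max_sq hk hkA, ← intervalIntegral.integral_const_mul]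
    congr 1
    ext s
    simp only [cutProfile]
    ring
  have hmono : ∫ ω, (a ω * d ω ^ 2 + 2 * (B * k) * (c ω - d ω) + a ω * (c ω - d ω) ^ 2) ∂μ
      ≤ ∫ ω, a ω * c ω ^ 2 ∂μ :=
    integral_mono_ae ((hiad.add ((hic.sub hid).const_mul _)).add hiacd) hiac
      (hcB.mono fun ω h => cutProfile_pointwise hB.le hk h.2)
  have hsplit : ∫ ω, (a ω * d ω ^ 2 + 2 * (B * k) * (c ω - d ω) + a ω * (c ω - d ω) ^ 2) ∂μ
      = ∫ ω, a ω * d ω ^ 2 ∂μ + 2 * (B * k) * (∫ ω, c ω ∂μ - ∫ ω, d ω ∂μ)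
        + ∫ ω, a ω * (c ω - d ω) ^ 2 ∂μ := by
    have e1 := integral_add (hiad.add ((hic.sub hid).const_mul (2 * (B * k)))) hiacd
    have e2 := integral_add hiad ((hic.sub hid).const_mul (2 * (B * k)))
    have e3 := integral_sub hic hid
    simp only [Pi.add_apply, Pi.sub_apply] at e1 e2 e3
    rw [e1, e2, integral_const_mul, e3]
  have hT' : ∫ ω, c ω ∂μ = B * k * (1 + L) := by rw [hT, hkdef]; ring
  rw [hsplit, hI2, hI1, hT'] at hmono
  have hfin : (A * B) ^ 2 / 2 * (L * Real.exp (-L)) ^ 2 = (B * k) ^ 2 / 2 * L ^ 2 := by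
    rw [hkdef]; ring
  rw [hT', hfin]
  linarith

theorem quadratic_le_and_eq (hA : 0 < A) (hB : 0 < B) (ha : Measurable a) (hc : Measurable c)
    (hmap : μ.map a = volume.restrict (Icc 0 A)) (hcB : ∀ᵐ ω ∂μ, c ω ∈ Icc 0 B) :
    (∫ ω, c ω ∂μ) ^ 2 / 2 - ∫ ω, a ω * c ω ^ 2 ∂μ ≤ (A * B * Real.exp (-1)) ^ 2 / 2 ∧
    ((∫ ω, c ω ∂μ) ^ 2 / 2 - ∫ ω, a ω * c ω ^ 2 ∂μ = (A * B * Real.exp (-1)) ^ 2 / 2 →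
      ∀ᵐ ω ∂μ, c ω = cutProfile B (A * Real.exp (-1)) (a ω)) := by
  have := isFiniteMeasure_of_map_eq ha hmap
  have hae := ae_mem_Icc_of_map_eq ha hmap
  have hpos : 0 < (A * B * Real.exp (-1)) ^ 2 / 2 := by positivity
  have hic : Integrable c μ := Integrable.of_bound hc.aestronglyMeasurable B
    (hcB.mono fun ω h => by rw [Real.norm_of_nonneg h.1]; exact h.2)
  have hT0 : 0 ≤ ∫ ω, c ω ∂μ := integral_nonneg_of_ae (hcB.mono fun ω h => h.1)
  have hone : ∫ _ω, (1 : ℝ) ∂μ = A := by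
    rw [integral_comp_of_map_eq (φ := fun _ => 1) hA.le ha hmap continuous_const]; simp
  have hTB : ∫ ω, c ω ∂μ ≤ A * B := by
    calc ∫ ω, c ω ∂μ ≤ ∫ _ω, B * 1 ∂μ :=
          integral_mono_ae hic (integrable_const _) (hcB.mono fun ω h => by simpa using h.2)
      _ = A * B := by rw [integral_const_mul, hone, mul_comm]
  have hnn : 0 ≤ ∫ ω, a ω * c ω ^ 2 ∂μ :=
    integral_nonneg_of_ae (hae.mono fun ω h => mul_nonneg h.1 (sq_nonneg _))
  -- No finite `L` corresponds to `∫ c = 0`; there the functional is nonpositive, so the bound is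
  -- strict.
  rcases hT0.eq_or_lt with h0 | h0
  · rw [← h0]
    refine ⟨by linarith, fun h => by linarith⟩
  obtain ⟨L, hL, hLT⟩ := exists_one_add_mul_exp_neg_eq (t := (∫ ω, c ω ∂μ) / (A * B))
    (by positivity) (by rw [div_le_one (by positivity)]; exact hTB)
  have hT : ∫ ω, c ω ∂μ = A * B * ((1 + L) * Real.exp (-L)) := by
    rw [hLT]; field_simp
  have hq := quadratic_bound hA hB ha hc hmap hcB hL hT
  have hnn2 : 0 ≤ᵐ[μ] fun ω => a ω * (c ω - cutProfile B (A * Real.exp (-L)) (a ω)) ^ 2 :=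
    hae.mono fun ω h => mul_nonneg h.1 (sq_nonneg _)
  have hI := integral_nonneg_of_ae hnn2
  have hle : (L * Real.exp (-L)) ^ 2 ≤ Real.exp (-1) ^ 2 :=
    pow_le_pow_left₀ (by positivity) (mul_exp_neg_le L) 2
  have hle' := mul_le_mul_of_nonneg_left hle (show 0 ≤ (A * B) ^ 2 / 2 by positivity)
  have heq : (A * B * Real.exp (-1)) ^ 2 / 2 = (A * B) ^ 2 / 2 * Real.exp (-1) ^ 2 := by ring
  rw [heq]
  refine ⟨by linarith, fun h => ?_⟩
  rw [h] at hq
  -- Equality leaves no room in `L * exp (-L) ≤ exp (-1)`, and afterwards none for the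
  -- square-distance term.
  have h1 : L = 1 := by
    apply eq_one_of_exp_neg_le
    have h2 : Real.exp (-1) ^ 2 ≤ (L * Real.exp (-L)) ^ 2 :=
      le_of_mul_le_mul_left (by linarith) (show 0 < (A * B) ^ 2 / 2 by positivity)
    exact le_of_sq_le_sq h2 (by positivity)
  subst h1
  have hz : ∫ ω, a ω * (c ω - cutProfile B (A * Real.exp (-1)) (a ω)) ^ 2 ∂μ = 0 := by
    apply le_antisymm _ hI
    rw [one_mul] at hq
    linarith
  have hk : 0 < A * Real.exp (-1) := by positivity
  have hint : Integrable
      (fun ω => a ω * (c ω - cutProfile B (A * Real.exp (-1)) (a ω)) ^ 2) μ := by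
    refine Integrable.of_bound (ha.mul ((hc.sub ((continuous_cutProfile
      hk).measurable.comp ha)).pow_const 2)).aestronglyMeasurable
      (A * B ^ 2) ?_
    filter_upwards [hae, hcB] with ω h1 h2
    have := cutProfile_mem_Icc hB.le hk (a ω)
    rw [Real.norm_eq_abs, abs_mul, abs_of_nonneg h1.1, abs_pow]
    refine mul_le_mul h1.2 (pow_le_pow_left₀ (abs_nonneg _) ?_ 2) (by positivity) hA.le
    rw [abs_le]; constructor <;> linarith [h2.1, h2.2, this.1, this.2]
  rw [integral_eq_zero_iff_of_nonneg_ae hnn2 hint] at hz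
  -- The weight `a` vanishes only on a null set, since its law is Lebesgue measure; hence the square
  -- itself vanishes a.e.
  have hne : ∀ᵐ ω ∂μ, a ω ≠ 0 := by
    have : ∀ᵐ s ∂(μ.map a), s ≠ 0 := by
      rw [hmap]; exact ae_restrict_of_ae (Measure.ae_ne volume 0)
    exact ae_of_ae_map ha.aemeasurable this
  filter_upwards [hz, hne] with ω h1 h2
  simp only [Pi.zero_apply, mul_eq_zero, h2, false_or] at h1
  have := pow_eq_zero_iff (two_ne_zero) |>.mp h1
  linarith

/-- For the extremal profile itself, the quadratic functional attains its bound. -/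
theorem quadratic_eq_of_eq (hA : 0 < A) (ha : Measurable a)
    (hmap : μ.map a = volume.restrict (Icc 0 A))
    (h : ∀ᵐ ω ∂μ, c ω = cutProfile B (A * Real.exp (-1)) (a ω)) :
    (∫ ω, c ω ∂μ) ^ 2 / 2 - ∫ ω, a ω * c ω ^ 2 ∂μ = (A * B * Real.exp (-1)) ^ 2 / 2 := by
  set k := A * Real.exp (-1) with hkdef
  have hk : 0 < k := by positivity
  have hkA : k ≤ A := by
    have : Real.exp (-1) ≤ 1 := Real.exp_le_one_iff.mpr (by linarith)
    nlinarith
  have hlog : Real.log (A / k) = 1 := by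
    rw [hkdef, div_mul_cancel_left₀ hA.ne', ← Real.exp_neg, neg_neg, Real.log_exp]
  have hI1 : ∫ ω, c ω ∂μ = B * k * (1 + 1) := by
    rw [integral_congr_ae h, integral_comp_of_map_eq hA.le ha hmap (continuous_cutProfile hk)]
    simp only [cutProfile]
    rw [intervalIntegral.integral_const_mul, integral_inv_max hk hkA, hlog]
  have hI := integral_mul_inv_max_sq hk hkA
  rw [hlog] at hI
  have hI2 : ∫ ω, a ω * c ω ^ 2 ∂μ = (B * k) ^ 2 * (1 / 2 + 1) := by
    rw [integral_congr_ae (g := fun ω => a ω * cutProfile B k (a ω) ^ 2)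
      (h.mono fun ω h => by simp only [h])]
    rw [integral_comp_of_map_eq (φ := fun s => s * cutProfile B k s ^ 2) hA.le ha hmap
      (continuous_id.mul ((continuous_cutProfile hk).pow 2)), ← hI,
      ← intervalIntegral.integral_const_mul]
    congr 1
    ext s
    simp only [cutProfile]
    ring
  rw [hI1, hI2, hkdef]
  ring

end Core

/-! ### Integrals over ordered simplices as iterated integrals -/

/-- Strictly increasing tuples with entries in `T`. -/
def simplexIn (k : ℕ) (T : Set ℝ) : Set (Fin k → ℝ) :=
  {x | StrictMono x ∧ ∀ i, x i ∈ T}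

/-- `∫_0^t u_k(s_k) ∫_0^{s_k} u_{k-1}(s_{k-1}) ⋯`. -/
noncomputable def iteratedPrimitive : (k : ℕ) → (Fin k → ℝ → ℝ) → ℝ → ℝ
  | 0, _, _ => 1
  | k + 1, u, t =>
    ∫ s in (0 : ℝ)..t, u (Fin.last k) s * iteratedPrimitive k (fun i => u i.castSucc) s

theorem measurableSet_simplexIn (k : ℕ) {T : Set ℝ} (hT : MeasurableSet T) :
    MeasurableSet (simplexIn k T) := by
  have : simplexIn k T =
      (⋂ i : Fin k, ⋂ j : Fin k, ⋂ _ : i < j, {x : Fin k → ℝ | x i < x j}) ∩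
        ⋂ i : Fin k, {x : Fin k → ℝ | x i ∈ T} := by
    ext x
    simp [simplexIn, StrictMono]
  rw [this]
  refine MeasurableSet.inter ?_ ?_
  · exact MeasurableSet.iInter fun i => MeasurableSet.iInter fun j => MeasurableSet.iInter fun _ =>
      measurableSet_lt (measurable_pi_apply i) (measurable_pi_apply j)
  · exact MeasurableSet.iInter fun i => measurable_pi_apply i hT

theorem mem_simplexIn_succ_iff {k : ℕ} {T : Set ℝ} (hT0 : T ⊆ Ici 0)
    (hTd : ∀ s ∈ T, Ico 0 s ⊆ T) (s : ℝ) (y : Fin k → ℝ) :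
    Fin.snoc (α := fun _ => ℝ) y s ∈ simplexIn (k + 1) T ↔ s ∈ T ∧ y ∈ simplexIn k (Ico 0 s) := by
  constructor
  · rintro ⟨hmono, hmem⟩
    have hs : s ∈ T := by simpa using hmem (Fin.last k)
    refine ⟨hs, fun i j hij => ?_, fun i => ⟨?_, ?_⟩⟩
    · have := hmono (Fin.castSucc_lt_castSucc_iff.mpr hij)
      simpa using this
    · have := hT0 (hmem i.castSucc)
      simpa using this
    · have := hmono (Fin.castSucc_lt_last i)
      simpa using this
  · rintro ⟨hs, hmono, hmem⟩
    refine ⟨?_, ?_⟩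
    · intro i j hij
      induction j using Fin.lastCases with
      | last =>
        induction i using Fin.lastCases with
        | last => exact absurd hij (lt_irrefl _)
        | cast i => simpa using (hmem i).2
      | cast j =>
        induction i using Fin.lastCases with
        | last => exact absurd hij (not_lt.mpr (Fin.le_last _))
        | cast i => simpa using hmono (Fin.castSucc_lt_castSucc_iff.mp hij)
    · intro i
      induction i using Fin.lastCases with
      | last => simpa using hs
      | cast i => simpa using hTd s hs (hmem i)

/-- Fubini with the largest coordinate outermost. Once it equals `s`, the others range over `Ico 0
s`, because `T` is closed downwards in the nonnegative reals. A general `T` covers both the closed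
outer domain and the half-open inner ones. -/
theorem setIntegral_simplexIn_succ {k : ℕ} {T : Set ℝ} (hTm : MeasurableSet T) {M : ℝ}
    (hT0 : T ⊆ Icc 0 M) (hTd : ∀ s ∈ T, Ico 0 s ⊆ T) {u : Fin (k + 1) → ℝ → ℝ}
    (hu : ∀ i, Measurable (u i)) (hu1 : ∀ i x, |u i x| ≤ 1) :
    ∫ x in simplexIn (k + 1) T, ∏ i, u i (x i) =
      ∫ s in T, u (Fin.last k) s * ∫ y in simplexIn k (Ico 0 s), ∏ i : Fin k, u i.castSucc (y i) := by
  have hS := measurableSet_simplexIn (k + 1) hTm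
  set Φ : (Fin (k + 1) → ℝ) → ℝ := (simplexIn (k + 1) T).indicator fun x => ∏ i, u i (x i) with hΦ
  have hprod : Measurable fun x : Fin (k + 1) → ℝ => ∏ i, u i (x i) :=
    Finset.measurable_prod _ fun i _ => (hu i).comp (measurable_pi_apply i)
  have hfin : volume (simplexIn (k + 1) T) ≠ ⊤ := by
    have hsub : simplexIn (k + 1) T ⊆ Icc (fun _ => (0 : ℝ)) (fun _ => M) := fun x hx =>
      ⟨fun i => (hT0 (hx.2 i)).1, fun i => (hT0 (hx.2 i)).2⟩
    exact ((measure_mono hsub).trans_lt isCompact_Icc.measure_lt_top).ne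
  have hbound : ∀ x : Fin (k + 1) → ℝ, ‖∏ i, u i (x i)‖ ≤ 1 := fun x => by
    rw [norm_prod]
    exact Finset.prod_le_one (fun i _ => norm_nonneg _) fun i _ => hu1 i _
  have hint : Integrable Φ := by
    rw [hΦ, integrable_indicator_iff hS]
    exact Measure.integrableOn_of_bounded hfin hprod.aestronglyMeasurable (ae_of_all _ hbound)
  set e := MeasurableEquiv.piFinSuccAbove (fun _ : Fin (k + 1) => ℝ) (Fin.last k) with he
  have hmp := (volume_preserving_piFinSuccAbove (fun _ : Fin (k + 1) => ℝ) (Fin.last k)).symm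
  have hesymm : ∀ (s : ℝ) (y : Fin k → ℝ), e.symm (s, y) = Fin.snoc (α := fun _ => ℝ) y s := by
    intro s y
    change Fin.insertNth (α := fun _ => ℝ) (Fin.last k) s y = _
    rw [Fin.insertNth_last']
  rw [← integral_indicator hS, ← hΦ, ← hmp.integral_comp' Φ]
  have hint' : Integrable (fun p => Φ (e.symm p)) (volume.prod volume) :=
    (hmp.integrable_comp_emb e.symm.measurableEmbedding).mpr hint
  rw [Measure.volume_eq_prod, integral_prod _ hint', ← integral_indicator hTm]
  congr 1
  ext s
  have hpt : ∀ y : Fin k → ℝ, Φ (e.symm (s, y)) = T.indicator (u (Fin.last k)) s *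
      (simplexIn k (Ico 0 s)).indicator (fun y => ∏ i : Fin k, u i.castSucc (y i)) y := by
    intro y
    rw [hesymm, hΦ]
    have hiff := mem_simplexIn_succ_iff (fun x hx => (hT0 hx).1) hTd s y
    by_cases h1 : s ∈ T
    · by_cases h2 : y ∈ simplexIn k (Ico 0 s)
      · rw [indicator_of_mem (hiff.mpr ⟨h1, h2⟩), indicator_of_mem h1, indicator_of_mem h2,
          Fin.prod_univ_castSucc]
        simp [mul_comm]
      · rw [indicator_of_notMem (fun h => h2 (hiff.mp h).2), indicator_of_notMem h2, mul_zero]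
    · rw [indicator_of_notMem (fun h => h1 (hiff.mp h).1), indicator_of_notMem h1, zero_mul]
  change ∫ y, Φ (e.symm (s, y)) = _
  simp_rw [hpt]
  rw [integral_const_mul, integral_indicator (measurableSet_simplexIn k measurableSet_Ico)]
  by_cases h1 : s ∈ T
  · rw [indicator_of_mem h1, indicator_of_mem h1]
  · rw [indicator_of_notMem h1, indicator_of_notMem h1, zero_mul]

theorem setIntegral_simplexIn_Ico {k : ℕ} {u : Fin k → ℝ → ℝ}
    (hu : ∀ i, Measurable (u i)) (hu1 : ∀ i x, |u i x| ≤ 1) {t : ℝ} (ht : 0 ≤ t) :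
    ∫ x in simplexIn k (Ico 0 t), ∏ i, u i (x i) = iteratedPrimitive k u t := by
  induction k generalizing t with
  | zero =>
    have : simplexIn 0 (Ico 0 t) = univ := by
      ext x; simp [simplexIn, Subsingleton.strictMono]
    simp [this, iteratedPrimitive, Measure.real, volume_pi]
  | succ k ih =>
    rw [setIntegral_simplexIn_succ measurableSet_Ico (M := t) Ico_subset_Icc_self
      (fun s hs => Ico_subset_Ico_right hs.2.le) hu hu1, iteratedPrimitive,
      intervalIntegral.integral_of_le ht, ← integral_Ico_eq_integral_Ioc]
    refine setIntegral_congr_fun measurableSet_Ico fun s hs => ?_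
    rw [ih (fun i => hu _) (fun i x => hu1 _ _) hs.1]

theorem setIntegral_orderedSimplex_succ {k : ℕ} {u : Fin (k + 1) → ℝ → ℝ}
    (hu : ∀ i, Measurable (u i)) (hu1 : ∀ i x, |u i x| ≤ 1) :
    ∫ x in orderedSimplex (k + 1), ∏ i, u i (x i) = iteratedPrimitive (k + 1) u 1 := by
  change ∫ x in simplexIn (k + 1) (Icc 0 1), _ = _
  rw [setIntegral_simplexIn_succ measurableSet_Icc (M := 1) subset_rfl
      (fun s hs x hx => ⟨hx.1, hx.2.le.trans hs.2⟩) hu hu1, iteratedPrimitive,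
      intervalIntegral.integral_of_le zero_le_one, ← integral_Icc_eq_integral_Ioc]
  refine setIntegral_congr_fun measurableSet_Icc fun s hs => ?_
  rw [setIntegral_simplexIn_Ico (fun i => hu _) (fun i x => hu1 _ _) hs.1]

/-! ### Pattern densities of sublebesgue measures -/

/-- The measure `f(x) dx` on `[0,1]`. -/
noncomputable def withUnitDensity (f : ℝ → ℝ) : Measure ℝ :=
  lebesgueUnit.withDensity fun x => ENNReal.ofReal (f x)

instance : IsFiniteMeasure lebesgueUnit := by unfold lebesgueUnit; infer_instance

theorem unitDensity_withUnitDensity {f : ℝ → ℝ} (hf : Measurable f)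
    (hf01 : ∀ x, f x ∈ Icc (0 : ℝ) 1) :
    unitDensity (withUnitDensity f) =ᵐ[lebesgueUnit] f := by
  filter_upwards [Measure.rnDeriv_withDensity lebesgueUnit hf.ennreal_ofReal] with x hx
  rw [unitDensity, withUnitDensity, hx, ENNReal.toReal_ofReal (hf01 x).1]

/-- The factor of the letter `b` in a pattern density. -/
def letterFactor (f : ℝ → ℝ) (b : Bool) (x : ℝ) : ℝ := if b = true then f x else 1 - f x

theorem measurable_letterFactor {f : ℝ → ℝ} (hf : Measurable f) (b : Bool) :
    Measurable (letterFactor f b) := by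
  cases b
  · exact measurable_const.sub hf
  · exact hf

theorem letterFactor_mem {f : ℝ → ℝ} (hf01 : ∀ x, f x ∈ Icc (0 : ℝ) 1) (b : Bool) (x : ℝ) :
    letterFactor f b x ∈ Icc (0 : ℝ) 1 := by
  have := hf01 x
  cases b
  · simp only [letterFactor]
    constructor <;> simp [this.1, this.2]
  · simpa [letterFactor] using this

theorem patternDensity_withUnitDensity {k : ℕ} (w : Fin (k + 1) → Bool) {f : ℝ → ℝ}
    (hf : Measurable f) (hf01 : ∀ x, f x ∈ Icc (0 : ℝ) 1) :
    patternDensity w (withUnitDensity f) =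
      ((k + 1).factorial : ℝ) * iteratedPrimitive (k + 1) (fun i => letterFactor f (w i)) 1 := by
  rw [patternDensity, ← setIntegral_orderedSimplex_succ
    (fun i => measurable_letterFactor hf _) fun i x => by
      have := letterFactor_mem hf01 (w i) x
      rw [abs_of_nonneg this.1]; exact this.2]
  congr 1
  have hm : MeasurableSet (orderedSimplex (k + 1)) :=
    measurableSet_simplexIn (k + 1) measurableSet_Icc
  refine setIntegral_congr_ae hm ?_
  have h := unitDensity_withUnitDensity hf hf01
  unfold lebesgueUnit at h
  rw [Filter.EventuallyEq, ae_restrict_iff' measurableSet_Icc] at h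
  have hall : ∀ᵐ x : Fin (k + 1) → ℝ, ∀ i, x i ∈ Icc (0 : ℝ) 1 →
      unitDensity (withUnitDensity f) (x i) = f (x i) :=
    ae_all_iff.mpr fun i => (Measure.quasiMeasurePreserving_eval
      (fun _ : Fin (k + 1) => (volume : Measure ℝ)) i).ae h
  filter_upwards [hall] with x hx hxS
  refine Finset.prod_congr rfl fun i _ => ?_
  rw [hx i (hxS.2 i), letterFactor]

theorem patternDensity_word1 {f : ℝ → ℝ} (hf : Measurable f)
    (hf01 : ∀ x, f x ∈ Icc (0 : ℝ) 1) :
    patternDensity word1 (withUnitDensity f) = ∫ x in (0 : ℝ)..1, f x := by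
  rw [patternDensity_withUnitDensity word1 hf hf01]
  simp [iteratedPrimitive, letterFactor, word1]

theorem patternDensity_word1010 {f : ℝ → ℝ} (hf : Measurable f)
    (hf01 : ∀ x, f x ∈ Icc (0 : ℝ) 1) :
    patternDensity word1010 (withUnitDensity f) = 24 *
      ∫ x in (0 : ℝ)..1, (1 - f x) * ∫ y in (0 : ℝ)..x, f y *
        ∫ z in (0 : ℝ)..y, (1 - f z) * ∫ t in (0 : ℝ)..z, f t := by
  rw [patternDensity_withUnitDensity word1010 hf hf01]
  simp [iteratedPrimitive, letterFactor, word1010, Nat.factorial, Fin.last]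

/-! ### Integration by parts and the quadratic form of the `1010` density -/

theorem integral_mul_primitive_add {u v : ℝ → ℝ} (hu : ∀ a b, IntervalIntegrable u volume a b)
    (hv : ∀ a b, IntervalIntegrable v volume a b) (t : ℝ) :
    (∫ x in (0 : ℝ)..t, u x * ∫ y in (0 : ℝ)..x, v y)
      + (∫ x in (0 : ℝ)..t, v x * ∫ y in (0 : ℝ)..x, u y)
      = (∫ x in (0 : ℝ)..t, u x) * ∫ x in (0 : ℝ)..t, v x := by
  -- The integrands are only integrable, so the primitives are differentiable merely a.e.; absolute
  -- continuity is what justifies integration by parts.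
  have hU := (hu 0 t).absolutelyContinuousOnInterval_intervalIntegral left_mem_uIcc
  have hV := (hv 0 t).absolutelyContinuousOnInterval_intervalIntegral left_mem_uIcc
  have h := hV.integral_mul_deriv_eq_deriv_mul hU
  have du := (hu 0 t).ae_hasDerivAt_integral
  have dv := (hv 0 t).ae_hasDerivAt_integral
  have e1 : ∫ x in (0 : ℝ)..t, (∫ y in (0 : ℝ)..x, v y) * deriv (fun x => ∫ y in (0 : ℝ)..x, u y) x
      = ∫ x in (0 : ℝ)..t, u x * ∫ y in (0 : ℝ)..x, v y := by
    refine intervalIntegral.integral_congr_ae ?_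
    filter_upwards [du] with x hx hxt
    rw [(hx (uIoc_subset_uIcc hxt) 0 left_mem_uIcc).deriv, mul_comm]
  have e2 : ∫ x in (0 : ℝ)..t, deriv (fun x => ∫ y in (0 : ℝ)..x, v y) x * (∫ y in (0 : ℝ)..x, u y)
      = ∫ x in (0 : ℝ)..t, v x * ∫ y in (0 : ℝ)..x, u y := by
    refine intervalIntegral.integral_congr_ae ?_
    filter_upwards [dv] with x hx hxt
    rw [(hx (uIoc_subset_uIcc hxt) 0 left_mem_uIcc).deriv]
  rw [e1, e2] at h
  simp only [intervalIntegral.integral_same, zero_mul, sub_zero] at h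
  linarith

/-- The mass of ones up to `x`. -/
noncomputable def onesBefore (f : ℝ → ℝ) (x : ℝ) : ℝ := ∫ y in (0 : ℝ)..x, f y

/-- The mass of zeros between `x` and `1`. -/
noncomputable def zerosAfter (f : ℝ → ℝ) (x : ℝ) : ℝ :=
  1 - onesBefore f 1 - (x - onesBefore f x)

section Density

variable {f : ℝ → ℝ}

theorem intervalIntegrable_of_mem_Icc (hf : Measurable f) (hf01 : ∀ x, f x ∈ Icc (0 : ℝ) 1)
    (a b : ℝ) : IntervalIntegrable f volume a b := by
  refine (intervalIntegrable_const (c := (1 : ℝ))).mono_fun hf.aestronglyMeasurable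
    (ae_of_all _ fun x => ?_)
  simp only [Real.norm_of_nonneg (hf01 x).1, norm_one]
  exact (hf01 x).2

theorem continuous_onesBefore (hf : Measurable f) (hf01 : ∀ x, f x ∈ Icc (0 : ℝ) 1) :
    Continuous (onesBefore f) :=
  intervalIntegral.continuous_primitive (intervalIntegrable_of_mem_Icc hf hf01) 0

theorem continuous_zerosAfter (hf : Measurable f) (hf01 : ∀ x, f x ∈ Icc (0 : ℝ) 1) :
    Continuous (zerosAfter f) :=
  continuous_const.sub (continuous_id.sub (continuous_onesBefore hf hf01))

theorem onesBefore_sub (hf : Measurable f) (hf01 : ∀ x, f x ∈ Icc (0 : ℝ) 1) (x y : ℝ) :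
    onesBefore f y - onesBefore f x = ∫ t in x..y, f t := by
  have h := intervalIntegrable_of_mem_Icc hf hf01
  rw [onesBefore, onesBefore, intervalIntegral.integral_interval_sub_left (h _ _) (h _ _)]

theorem onesBefore_mono (hf : Measurable f) (hf01 : ∀ x, f x ∈ Icc (0 : ℝ) 1) :
    Monotone (onesBefore f) := by
  intro x y hxy
  have := onesBefore_sub hf hf01 x y
  have h2 := intervalIntegral.integral_nonneg (μ := volume) hxy fun t _ => (hf01 t).1
  linarith

theorem onesBefore_sub_le (hf : Measurable f) (hf01 : ∀ x, f x ∈ Icc (0 : ℝ) 1) {x y : ℝ}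
    (hxy : x ≤ y) : onesBefore f y - onesBefore f x ≤ y - x := by
  have h := intervalIntegrable_of_mem_Icc hf hf01
  rw [onesBefore_sub hf hf01]
  have h2 := intervalIntegral.integral_mono_on (μ := volume) (g := fun _ => (1 : ℝ)) hxy (h _ _)
    intervalIntegrable_const fun t _ => (hf01 t).2
  simpa using h2

@[simp]
theorem onesBefore_zero (f : ℝ → ℝ) : onesBefore f 0 = 0 := by simp [onesBefore]

theorem onesBefore_mem (hf : Measurable f) (hf01 : ∀ x, f x ∈ Icc (0 : ℝ) 1) {x : ℝ}
    (hx : x ∈ Icc (0 : ℝ) 1) : onesBefore f x ∈ Icc 0 (onesBefore f 1) :=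
  ⟨by simpa using onesBefore_mono hf hf01 hx.1, onesBefore_mono hf hf01 hx.2⟩

theorem onesBefore_one_mem (hf : Measurable f) (hf01 : ∀ x, f x ∈ Icc (0 : ℝ) 1) :
    onesBefore f 1 ∈ Icc (0 : ℝ) 1 :=
  ⟨(onesBefore_mem hf hf01 (right_mem_Icc.mpr zero_le_one)).1,
    by simpa using onesBefore_sub_le hf hf01 zero_le_one⟩

theorem zerosAfter_mem (hf : Measurable f) (hf01 : ∀ x, f x ∈ Icc (0 : ℝ) 1) {x : ℝ}
    (hx : x ∈ Icc (0 : ℝ) 1) : zerosAfter f x ∈ Icc 0 (1 - onesBefore f 1) := by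
  have h1 := onesBefore_sub_le hf hf01 hx.1
  have h2 := onesBefore_sub_le hf hf01 hx.2
  rw [onesBefore_zero] at h1
  unfold zerosAfter
  constructor <;> linarith

theorem patternDensity_word1010_eq (hf : Measurable f) (hf01 : ∀ x, f x ∈ Icc (0 : ℝ) 1) :
    patternDensity word1010 (withUnitDensity f) = 24 *
      ((∫ x in (0 : ℝ)..1, f x * zerosAfter f x) ^ 2 / 2 -
        ∫ x in (0 : ℝ)..1, f x * (onesBefore f x * zerosAfter f x ^ 2)) := by
  rw [patternDensity_word1010 hf hf01]
  congr 1
  have hfi := intervalIntegrable_of_mem_Icc hf hf01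
  have hcF := continuous_onesBefore hf hf01
  have hcC := continuous_zerosAfter hf hf01
  have hgi : ∀ a b, IntervalIntegrable (fun x => 1 - f x) volume a b := fun a b =>
    intervalIntegrable_const.sub (hfi a b)
  have hfm : ∀ {φ : ℝ → ℝ}, Continuous φ → ∀ a b, IntervalIntegrable (fun x => f x * φ x) volume a b :=
    fun hφ a b => (hfi a b).mul_continuousOn hφ.continuousOn
  have hb : ∀ x, ∫ y in (0 : ℝ)..x, (1 - f y) = x - onesBefore f x := fun x => by
    rw [intervalIntegral.integral_sub intervalIntegrable_const (hfi _ _)]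
    simp [onesBefore]
  have hcb : Continuous fun x => x - onesBefore f x := continuous_id.sub hcF
  set U : ℝ → ℝ := fun y => ∫ x in (0 : ℝ)..y, f x * zerosAfter f x with hU
  have hcU : Continuous U := intervalIntegral.continuous_primitive (hfm hcC) 0
  -- The mass of 10 before `y`, counted by its 1: a one at `x` is followed by `zerosAfter f x -
  -- zerosAfter f y` zeros before `y`.
  have hG : ∀ y, (∫ z in (0 : ℝ)..y, (1 - f z) * ∫ t in (0 : ℝ)..z, f t) =
      U y - onesBefore f y * zerosAfter f y := fun y => by
    have h := integral_mul_primitive_add hgi hfi y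
    simp only [hb] at h
    have h2 : U y = (1 - onesBefore f 1) * onesBefore f y -
        ∫ x in (0 : ℝ)..y, f x * (x - onesBefore f x) := by
      rw [hU]
      simp only
      rw [onesBefore, onesBefore, ← intervalIntegral.integral_const_mul,
        ← intervalIntegral.integral_sub ((hfi _ _).const_mul _) (hfm hcb _ _)]
      refine intervalIntegral.integral_congr fun x _ => ?_
      simp only [zerosAfter, onesBefore]
      ring
    change _ + _ = (y - onesBefore f y) * onesBefore f y at h
    rw [h2]
    unfold zerosAfter
    linarith
  simp only [hG]
  have hcG : Continuous fun y => U y - onesBefore f y * zerosAfter f y := hcU.sub (hcF.mul hcC)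
  have hK := integral_mul_primitive_add hgi (hfm hcG) 1
  simp only [hb] at hK
  have hTU := integral_mul_primitive_add (hfm hcC) (hfm hcC) 1
  -- The right side is the outer integral after integration by parts: the final 0 contributes the
  -- factor `zerosAfter f x`. On the left, `U` is the primitive of `f * zerosAfter f`, so `hTU`
  -- evaluates the first integral as `U 1 ^ 2 / 2`.
  have e : (∫ x in (0 : ℝ)..1, (f x * zerosAfter f x) * U x) -
      ∫ x in (0 : ℝ)..1, f x * (onesBefore f x * zerosAfter f x ^ 2) =
      (1 - onesBefore f 1) * (∫ x in (0 : ℝ)..1, f x * (U x - onesBefore f x * zerosAfter f x)) -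
      ∫ x in (0 : ℝ)..1, f x * (U x - onesBefore f x * zerosAfter f x) * (x - onesBefore f x) := by
    have i1 : IntervalIntegrable (fun x => f x * zerosAfter f x * U x) volume 0 1 :=
      (hfm hcC _ _).mul_continuousOn hcU.continuousOn
    have i2 : IntervalIntegrable (fun x => f x * (U x - onesBefore f x * zerosAfter f x) *
        (x - onesBefore f x)) volume 0 1 :=
      (hfm hcG _ _).mul_continuousOn hcb.continuousOn
    rw [← intervalIntegral.integral_const_mul,
      ← intervalIntegral.integral_sub i1 (hfm (φ := fun x => onesBefore f x * zerosAfter f x ^ 2)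
        (hcF.mul (hcC.pow 2)) _ _),
      ← intervalIntegral.integral_sub ((hfm hcG _ _).const_mul _) i2]
    refine intervalIntegral.integral_congr fun x _ => ?_
    simp only [zerosAfter]
    ring
  change (∫ x in (0 : ℝ)..1, (f x * zerosAfter f x) * U x) +
    (∫ x in (0 : ℝ)..1, (f x * zerosAfter f x) * U x) = U 1 * U 1 at hTU
  change _ = U 1 ^ 2 / 2 - _
  linarith

/-! ### The mass function pushes a sublebesgue measure forward to Lebesgue measure -/

theorem integral_withUnitDensity (hf : Measurable f) (hf01 : ∀ x, f x ∈ Icc (0 : ℝ) 1)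
    (φ : ℝ → ℝ) : ∫ x, φ x ∂withUnitDensity f = ∫ x in (0 : ℝ)..1, f x * φ x := by
  rw [withUnitDensity, integral_withDensity_eq_integral_toReal_smul hf.ennreal_ofReal
    (ae_of_all _ fun _ => ENNReal.ofReal_lt_top), lebesgueUnit,
    intervalIntegral.integral_of_le zero_le_one, integral_Icc_eq_integral_Ioc]
  refine integral_congr_ae (ae_of_all _ fun x => ?_)
  simp [ENNReal.toReal_ofReal (hf01 x).1]

theorem withUnitDensity_Icc (hf : Measurable f) (hf01 : ∀ x, f x ∈ Icc (0 : ℝ) 1) {y : ℝ}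
    (hy : y ∈ Icc (0 : ℝ) 1) :
    withUnitDensity f (Icc 0 y) = ENNReal.ofReal (onesBefore f y) := by
  rw [withUnitDensity, withDensity_apply _ measurableSet_Icc, lebesgueUnit,
    Measure.restrict_restrict measurableSet_Icc,
    inter_eq_left.mpr (Icc_subset_Icc_right hy.2), onesBefore,
    intervalIntegral.integral_of_le hy.1, ← integral_Icc_eq_integral_Ioc,
    ofReal_integral_eq_lintegral_ofReal _ (ae_of_all _ fun x => (hf01 x).1)]
  have := (intervalIntegrable_iff_integrableOn_Icc_of_le hy.1).mp
    (intervalIntegrable_of_mem_Icc hf hf01 0 y)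
  exact this

theorem ae_withUnitDensity_mem : ∀ᵐ x ∂withUnitDensity f, x ∈ Icc (0 : ℝ) 1 :=
  (withDensity_absolutelyContinuous _ _).ae_le (ae_restrict_mem measurableSet_Icc)

theorem isFiniteMeasure_withUnitDensity (hf : Measurable f) (hf01 : ∀ x, f x ∈ Icc (0 : ℝ) 1) :
    IsFiniteMeasure (withUnitDensity f) := by
  constructor
  have h : withUnitDensity f univ = withUnitDensity f (Icc 0 1) :=
    measure_congr (ae_withUnitDensity_mem.mono fun x hx =>
      propext ⟨fun _ => hx, fun _ => trivial⟩)
  rw [h, withUnitDensity_Icc hf hf01 (right_mem_Icc.mpr zero_le_one)]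
  exact ENNReal.ofReal_lt_top

/-- A measure without atoms is carried to Lebesgue measure by its own distribution function. It
suffices to compare both sides on half-lines. -/
theorem map_onesBefore (hf : Measurable f) (hf01 : ∀ x, f x ∈ Icc (0 : ℝ) 1) :
    (withUnitDensity f).map (onesBefore f) = volume.restrict (Icc 0 (onesBefore f 1)) := by
  have := isFiniteMeasure_withUnitDensity hf hf01
  have hc := continuous_onesBefore hf hf01
  have hmono := onesBefore_mono hf hf01
  refine Measure.ext_of_Iic _ _ fun t => ?_
  rw [Measure.map_apply hc.measurable measurableSet_Iic, Measure.restrict_apply measurableSet_Iic,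
    show Iic t ∩ Icc 0 (onesBefore f 1) = Icc 0 (min (onesBefore f 1) t) by
      ext x; simp only [mem_inter_iff, mem_Iic, mem_Icc, le_min_iff]; tauto]
  have hset : withUnitDensity f (onesBefore f ⁻¹' Iic t) =
      withUnitDensity f (Icc 0 1 ∩ onesBefore f ⁻¹' Iic t) :=
    measure_congr (ae_withUnitDensity_mem.mono fun x hx =>
      propext ⟨fun h => ⟨hx, h⟩, fun h => h.2⟩)
  rw [hset, Real.volume_Icc, sub_zero]
  rcases lt_or_ge t 0 with ht | ht
  · have : Icc 0 1 ∩ onesBefore f ⁻¹' Iic t = ∅ := by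
      ext x
      simp only [mem_inter_iff, mem_preimage, mem_Iic, mem_empty_iff_false, iff_false, not_and]
      intro hx h
      have := (onesBefore_mem hf hf01 hx).1
      linarith
    rw [this, measure_empty, ENNReal.ofReal_of_nonpos ((min_le_right _ _).trans ht.le)]
  rcases le_or_gt (onesBefore f 1) t with h1 | h1
  · have : Icc 0 1 ∩ onesBefore f ⁻¹' Iic t = Icc 0 1 :=
      inter_eq_left.mpr fun x hx => (onesBefore_mem hf hf01 hx).2.trans h1
    rw [this, withUnitDensity_Icc hf hf01 (right_mem_Icc.mpr zero_le_one), min_eq_left h1]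
  have hK : IsCompact (Icc 0 1 ∩ onesBefore f ⁻¹' Iic t) :=
    isCompact_Icc.inter_right (isClosed_Iic.preimage hc)
  -- `onesBefore f` may have flat pieces, so the sublevel set is described by its largest point,
  -- where continuity forces the value `t`.
  obtain ⟨y, hy⟩ := hK.exists_isGreatest
    ⟨0, left_mem_Icc.mpr zero_le_one, by simpa using ht⟩
  have hy01 := hy.1.1
  have hFy : onesBefore f y = t := by
    refine le_antisymm hy.1.2 ?_
    obtain ⟨z, hz, hzt⟩ := intermediate_value_Icc hy01.2 hc.continuousOn
      (show t ∈ Icc (onesBefore f y) (onesBefore f 1) from ⟨hy.1.2, h1.le⟩)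
    have : z ≤ y := hy.2 ⟨⟨hy01.1.trans hz.1, hz.2⟩, hzt.le⟩
    rw [← hzt]
    exact hmono this
  have hseteq : Icc 0 1 ∩ onesBefore f ⁻¹' Iic t = Icc 0 y := by
    ext x
    refine ⟨fun hx => ⟨hx.1.1, hy.2 hx⟩, fun hx => ⟨⟨hx.1, hx.2.trans hy01.2⟩, ?_⟩⟩
    exact (hmono hx.2).trans hFy.le
  rw [hseteq, withUnitDensity_Icc hf hf01 hy01, hFy, min_eq_right h1.le]

/-! ### The upper bound for sublebesgue measures -/

theorem patternDensity_word1010_eq_quadratic (hf : Measurable f)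
    (hf01 : ∀ x, f x ∈ Icc (0 : ℝ) 1) :
    patternDensity word1010 (withUnitDensity f) = 24 *
      ((∫ x, zerosAfter f x ∂withUnitDensity f) ^ 2 / 2 -
        ∫ x, onesBefore f x * zerosAfter f x ^ 2 ∂withUnitDensity f) := by
  rw [patternDensity_word1010_eq hf hf01, integral_withUnitDensity hf hf01,
    integral_withUnitDensity hf hf01]

theorem ae_zerosAfter_mem (hf : Measurable f) (hf01 : ∀ x, f x ∈ Icc (0 : ℝ) 1) :
    ∀ᵐ x ∂withUnitDensity f, zerosAfter f x ∈ Icc 0 (1 - onesBefore f 1) :=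
  ae_withUnitDensity_mem.mono fun _ hx => zerosAfter_mem hf hf01 hx

/-- Covers the cases excluded by the strict positivity of `A` and `B` in the abstract problem. -/
theorem patternDensity_word1010_of_degenerate (hf : Measurable f)
    (hf01 : ∀ x, f x ∈ Icc (0 : ℝ) 1) (h : onesBefore f 1 = 0 ∨ onesBefore f 1 = 1) :
    patternDensity word1010 (withUnitDensity f) = 0 := by
  have hz : ∀ᵐ x ∂withUnitDensity f, zerosAfter f x = 0 := by
    rcases h with h | h
    · have : withUnitDensity f = 0 := by
        have h2 := withUnitDensity_Icc hf hf01 (right_mem_Icc.mpr zero_le_one)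
        rw [h, ENNReal.ofReal_zero] at h2
        rw [← Measure.measure_univ_eq_zero, ← h2]
        exact measure_congr (ae_withUnitDensity_mem.mono fun x hx =>
          propext ⟨fun _ => hx, fun _ => trivial⟩)
      rw [this]
      exact ae_zero.symm ▸ Filter.eventually_bot
    · filter_upwards [ae_zerosAfter_mem hf hf01] with x hx
      rw [h, sub_self] at hx
      exact le_antisymm hx.2 hx.1
  rw [patternDensity_word1010_eq_quadratic hf hf01, integral_eq_zero_of_ae hz,
    integral_eq_zero_of_ae (hz.mono fun x hx => by simp [hx])]
  simp

theorem patternDensity_word1010_le (hf : Measurable f) (hf01 : ∀ x, f x ∈ Icc (0 : ℝ) 1) :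
    patternDensity word1010 (withUnitDensity f) ≤
      12 * (onesBefore f 1 * (1 - onesBefore f 1) * Real.exp (-1)) ^ 2 := by
  have hA := onesBefore_one_mem hf hf01
  rcases hA.1.eq_or_lt with h0 | h0
  · rw [patternDensity_word1010_of_degenerate hf hf01 (Or.inl h0.symm)]; positivity
  rcases hA.2.eq_or_lt with h1 | h1
  · rw [patternDensity_word1010_of_degenerate hf hf01 (Or.inr h1)]; positivity
  rw [patternDensity_word1010_eq_quadratic hf hf01]
  have := (quadratic_le_and_eq h0 (sub_pos.mpr h1) (continuous_onesBefore hf hf01).measurable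
    (continuous_zerosAfter hf hf01).measurable (map_onesBefore hf hf01)
    (ae_zerosAfter_mem hf hf01)).1
  linarith

end Density

/-! ### Uniqueness of the maximizer -/

section Uniqueness

variable {f : ℝ → ℝ}

theorem withUnitDensity_congr {g : ℝ → ℝ} (hf : Measurable f) (hf01 : ∀ x, f x ∈ Icc (0 : ℝ) 1)
    (hg : Measurable g) (hg01 : ∀ x, g x ∈ Icc (0 : ℝ) 1)
    (h : ∀ x ∈ Icc (0 : ℝ) 1, onesBefore f x = onesBefore g x) :
    withUnitDensity f = withUnitDensity g := by
  have := isFiniteMeasure_withUnitDensity hf hf01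
  refine Measure.ext_of_Iic _ _ fun t => ?_
  have key : ∀ φ : ℝ → ℝ, withUnitDensity φ (Iic t) = withUnitDensity φ (Icc 0 (min 1 t)) :=
    fun φ => measure_congr (ae_withUnitDensity_mem.mono fun x hx =>
      propext ⟨fun h => ⟨hx.1, le_min hx.2 h⟩, fun h => h.2.trans (min_le_right _ _)⟩)
  rw [key, key]
  rcases lt_or_ge t 0 with ht | ht
  · rw [Icc_eq_empty (by simp [ht]), measure_empty, measure_empty]
  · have hm : min 1 t ∈ Icc (0 : ℝ) 1 := ⟨le_min zero_le_one ht, min_le_left _ _⟩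
    rw [withUnitDensity_Icc hf hf01 hm, withUnitDensity_Icc hg hg01 hm, h _ hm]

/-- The balance function, which is constant on the support of an optimal measure. -/
noncomputable def balance (f : ℝ → ℝ) (k x : ℝ) : ℝ := max (onesBefore f x) k * zerosAfter f x

theorem continuous_balance (hf : Measurable f) (hf01 : ∀ x, f x ∈ Icc (0 : ℝ) 1) (k : ℝ) :
    Continuous (balance f k) :=
  ((continuous_onesBefore hf hf01).max continuous_const).mul (continuous_zerosAfter hf hf01)

theorem zerosAfter_eq_cutProfile_iff {k B : ℝ} (hk : 0 < k) (x : ℝ) :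
    zerosAfter f x = cutProfile B k (onesBefore f x) ↔ balance f k x = B * k := by
  have hm : 0 < max (onesBefore f x) k := lt_max_of_lt_right hk
  rw [balance, cutProfile, ← div_eq_mul_inv, eq_div_iff hm.ne', mul_comm]

/-- On an interval where the balance avoids its a.e. value, `f` must vanish a.e. -/
theorem onesBefore_eq_of_ae_balance (hf : Measurable f) (hf01 : ∀ x, f x ∈ Icc (0 : ℝ) 1)
    {k v : ℝ} (h : ∀ᵐ x ∂withUnitDensity f, balance f k x = v) {x y : ℝ}
    (hx : 0 ≤ x) (hxy : x ≤ y) (hy : y ≤ 1) (hno : ∀ z ∈ Ioo x y, balance f k z ≠ v) :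
    onesBefore f x = onesBefore f y := by
  have h2 : ∀ᵐ z ∂lebesgueUnit, ENNReal.ofReal (f z) ≠ 0 → balance f k z = v :=
    (ae_withDensity_iff hf.ennreal_ofReal).mp h
  rw [lebesgueUnit, ae_restrict_iff' measurableSet_Icc] at h2
  have h3 : ∫ t in x..y, f t = ∫ _t in x..y, (0 : ℝ) := by
    refine intervalIntegral.integral_congr_ae ?_
    filter_upwards [h2, Measure.ae_ne volume y] with t ht hty htxy
    rw [uIoc_of_le hxy] at htxy
    by_contra hne
    have hpos : 0 < f t := lt_of_le_of_ne (hf01 t).1 (Ne.symm hne)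
    exact hno t ⟨htxy.1, lt_of_le_of_ne htxy.2 hty⟩ (ht ⟨hx.trans htxy.1.le, htxy.2.trans hy⟩
      (ENNReal.ofReal_pos.mpr hpos).ne')
  have h4 := onesBefore_sub hf hf01 x y
  rw [h3] at h4
  simp only [intervalIntegral.integral_const, smul_zero] at h4
  linarith

theorem balance_lt_of_onesBefore_eq {k x y : ℝ} (hk : 0 < k) (hxy : x < y)
    (h : onesBefore f x = onesBefore f y) : balance f k y < balance f k x := by
  unfold balance zerosAfter
  rw [h]
  exact mul_lt_mul_of_pos_left (by linarith) (lt_max_of_lt_right hk)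

/-- Consider a gap in the closed set where the balance equals its a.e. value. `onesBefore f` is
constant across the gap, so the balance strictly decreases there; it cannot return to the same value
at a right endpoint. Hence the only possible gap extends to 1 with all ones already used, and its
left end is `q` by the equation `hq`. -/
theorem balance_eq_and_onesBefore_eq (hf : Measurable f) (hf01 : ∀ x, f x ∈ Icc (0 : ℝ) 1)
    {k q : ℝ} (hk : 0 < k) (hkA : k ≤ onesBefore f 1)
    (hq : onesBefore f 1 * (1 - q) = (1 - onesBefore f 1) * k)
    (h : ∀ᵐ x ∂withUnitDensity f, balance f k x = (1 - onesBefore f 1) * k)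
    {x : ℝ} (hx : x ∈ Icc (0 : ℝ) 1) :
    balance f k x = (1 - onesBefore f 1) * k ∨ (q < x ∧ onesBefore f x = onesBefore f 1) := by
  by_contra! hcon
  obtain ⟨hxS, hcon⟩ := hcon
  set v := (1 - onesBefore f 1) * k with hv
  have hcl : IsClosed {z | balance f k z = v} :=
    isClosed_eq (continuous_balance hf hf01 k) continuous_const
  have h0 : balance f k 0 = v := by
    simp [balance, zerosAfter, hv, max_eq_right hk.le, mul_comm]
  -- The left end of the gap around `x`; it exists because 0 belongs to the set.
  obtain ⟨s, ⟨hs, hsS⟩, hsmax⟩ := (isCompact_Icc (a := 0) (b := x).inter_right hcl).exists_isGreatest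
    ⟨0, ⟨le_rfl, hx.1⟩, h0⟩
  have hsx : s < x := lt_of_le_of_ne hs.2 fun heq => hxS (heq ▸ hsS)
  have hFs : onesBefore f s = onesBefore f x :=
    onesBefore_eq_of_ae_balance hf hf01 h hs.1 hsx.le hx.2 fun z hz hzS =>
      absurd (hsmax ⟨⟨hs.1.trans hz.1.le, hz.2.le⟩, hzS⟩) (not_le.mpr hz.1)
  have hlt := balance_lt_of_onesBefore_eq hk hsx hFs
  rw [show balance f k s = v from hsS] at hlt
  by_cases hne : (Icc x 1 ∩ {z | balance f k z = v}).Nonempty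
  · obtain ⟨r, ⟨hr, hrS⟩, hrmin⟩ := (isCompact_Icc.inter_right hcl).exists_isLeast hne
    have hrx : x < r := lt_of_le_of_ne hr.1 fun heq => hxS (heq ▸ hrS)
    have hFr : onesBefore f x = onesBefore f r :=
      onesBefore_eq_of_ae_balance hf hf01 h hx.1 hrx.le hr.2 fun z hz hzS =>
        absurd (hrmin ⟨⟨hz.1.le, hz.2.le.trans hr.2⟩, hzS⟩) (not_le.mpr hz.2)
    have hlt2 := balance_lt_of_onesBefore_eq hk hrx hFr
    rw [show balance f k r = v from hrS] at hlt2
    linarith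
  · have hF1 : onesBefore f x = onesBefore f 1 :=
      onesBefore_eq_of_ae_balance hf hf01 h hx.1 hx.2 le_rfl fun z hz hzS =>
        hne ⟨z, ⟨hz.1.le, hz.2.le⟩, hzS⟩
    refine hcon ?_ hF1
    have hsv : balance f k s = v := hsS
    rw [balance, zerosAfter, hFs, hF1, max_eq_left hkA, ← hq] at hsv
    have := mul_left_cancel₀ (hk.trans_le hkA).ne' hsv
    linarith

/-- For fixed `x`, raising the mass of ones raises both factors of the balance, strictly in the
second. Thus the balance equation determines `onesBefore f x`. -/
theorem balance_injective {k x a b A : ℝ} {v : ℝ} (hk : 0 < k) (hv : 0 < v)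
    (ha : max a k * (1 - A - (x - a)) = v) (hb : max b k * (1 - A - (x - b)) = v) : a = b := by
  have aux : ∀ {a b : ℝ}, max a k * (1 - A - (x - a)) = v → max b k * (1 - A - (x - b)) = v →
      ¬ a < b := by
    intro a b ha hb hab
    have hpos : 0 < 1 - A - (x - a) :=
      pos_of_mul_pos_right (ha ▸ hv) (lt_max_of_lt_right hk).le
    have h1 : max a k ≤ max b k := max_le_max hab.le le_rfl
    have h2 : 0 < max b k := lt_max_of_lt_right hk
    nlinarith [mul_le_mul_of_nonneg_right h1 hpos.le]
  exact le_antisymm (not_lt.mp (aux hb ha)) (not_lt.mp (aux ha hb))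

theorem onesBefore_eq_of_ae_balance_eq {g : ℝ → ℝ} (hf : Measurable f)
    (hf01 : ∀ x, f x ∈ Icc (0 : ℝ) 1) (hg : Measurable g) (hg01 : ∀ x, g x ∈ Icc (0 : ℝ) 1)
    (hfg : onesBefore f 1 = onesBefore g 1) {k : ℝ} (hk : 0 < k) (hkA : k ≤ onesBefore f 1)
    (hA1 : onesBefore f 1 < 1)
    (hbf : ∀ᵐ x ∂withUnitDensity f, balance f k x = (1 - onesBefore f 1) * k)
    (hbg : ∀ᵐ x ∂withUnitDensity g, balance g k x = (1 - onesBefore g 1) * k)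
    {x : ℝ} (hx : x ∈ Icc (0 : ℝ) 1) : onesBefore f x = onesBefore g x := by
  have hA : 0 < onesBefore f 1 := hk.trans_le hkA
  -- The point where the balance takes its required value with all ones already used. It depends
  -- only on the total mass and `k`, so it is common to `f` and `g`.
  set q := 1 - (1 - onesBefore f 1) * k / onesBefore f 1 with hqdef
  have hq : onesBefore f 1 * (1 - q) = (1 - onesBefore f 1) * k := by
    rw [hqdef]; field_simp; ring
  have hq0 : 0 ≤ q := by
    rw [hqdef, sub_nonneg, div_le_one hA]; nlinarith
  have hq1 : q ≤ 1 := by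
    rw [hqdef, sub_le_self_iff]
    have : 0 ≤ 1 - onesBefore f 1 := by linarith
    positivity
  have hv : 0 < (1 - onesBefore f 1) * k := mul_pos (by linarith) hk
  have Hf := fun {x : ℝ} (hx : x ∈ Icc (0 : ℝ) 1) =>
    balance_eq_and_onesBefore_eq hf hf01 hk hkA hq hbf hx
  have Hg := fun {x : ℝ} (hx : x ∈ Icc (0 : ℝ) 1) =>
    balance_eq_and_onesBefore_eq hg hg01 hk (hfg ▸ hkA) (hfg ▸ hq) hbg hx
  have hle : ∀ {x : ℝ}, x ∈ Icc 0 q → onesBefore f x = onesBefore g x := by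
    intro x hx
    have hx1 : x ∈ Icc (0 : ℝ) 1 := ⟨hx.1, hx.2.trans hq1⟩
    have h1 := (Hf hx1).resolve_right fun h => absurd hx.2 (not_le.mpr h.1)
    have h2 := (Hg hx1).resolve_right fun h => absurd hx.2 (not_le.mpr h.1)
    rw [← hfg] at h2
    rw [balance, zerosAfter] at h1 h2
    rw [← hfg] at h2
    exact balance_injective hk hv h1 h2
  rcases le_or_gt x q with hxq | hxq
  · exact hle ⟨hx.1, hxq⟩
  have hqm : q ∈ Icc (0 : ℝ) 1 := ⟨hq0, hq1⟩
  have hFq : onesBefore f q = onesBefore f 1 := by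
    have h1 := (Hf hqm).resolve_right fun h => lt_irrefl _ h.1
    rw [balance, zerosAfter] at h1
    refine balance_injective (A := onesBefore f 1) (x := q) hk hv h1 ?_
    rw [max_eq_left hkA, ← hq]; ring
  have hGq : onesBefore g q = onesBefore g 1 := by
    rw [← hle ⟨hq0, le_rfl⟩, hFq, hfg]
  have e1 : onesBefore f x = onesBefore f 1 :=
    le_antisymm (onesBefore_mono hf hf01 hx.2) (hFq ▸ onesBefore_mono hf hf01 hxq.le)
  have e2 : onesBefore g x = onesBefore g 1 :=
    le_antisymm (onesBefore_mono hg hg01 hx.2) (hGq ▸ onesBefore_mono hg hg01 hxq.le)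
  rw [e1, e2, hfg]

theorem withUnitDensity_unique {g : ℝ → ℝ} (hf : Measurable f)
    (hf01 : ∀ x, f x ∈ Icc (0 : ℝ) 1) (hg : Measurable g) (hg01 : ∀ x, g x ∈ Icc (0 : ℝ) 1)
    (hfg : onesBefore f 1 = onesBefore g 1)
    (h1 : patternDensity word1010 (withUnitDensity f) =
      12 * (onesBefore f 1 * (1 - onesBefore f 1) * Real.exp (-1)) ^ 2)
    (h2 : patternDensity word1010 (withUnitDensity g) =
      12 * (onesBefore g 1 * (1 - onesBefore g 1) * Real.exp (-1)) ^ 2) :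
    withUnitDensity f = withUnitDensity g := by
  refine withUnitDensity_congr hf hf01 hg hg01 fun x hx => ?_
  have hA := onesBefore_one_mem hf hf01
  rcases hA.1.eq_or_lt with h0 | h0
  · have e1 := onesBefore_mem hf hf01 hx
    have e2 := onesBefore_mem hg hg01 hx
    rw [← hfg, ← h0] at e2
    rw [← h0] at e1
    linarith [e1.1, e1.2, e2.1, e2.2]
  rcases hA.2.eq_or_lt with hA1 | hA1
  · have e1 := zerosAfter_mem hf hf01 hx
    have e2 := zerosAfter_mem hg hg01 hx
    unfold zerosAfter at e1 e2
    rw [← hfg, hA1] at e2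
    rw [hA1] at e1
    linarith [e1.1, e1.2, e2.1, e2.2]
  have hk : 0 < onesBefore f 1 * Real.exp (-1) := by positivity
  have hkA : onesBefore f 1 * Real.exp (-1) ≤ onesBefore f 1 :=
    mul_le_of_le_one_right h0.le (Real.exp_le_one_iff.mpr (by norm_num))
  have key : ∀ {φ : ℝ → ℝ}, Measurable φ → (∀ x, φ x ∈ Icc (0 : ℝ) 1) →
      0 < onesBefore φ 1 → onesBefore φ 1 < 1 →
      patternDensity word1010 (withUnitDensity φ) =
        12 * (onesBefore φ 1 * (1 - onesBefore φ 1) * Real.exp (-1)) ^ 2 →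
      ∀ᵐ x ∂withUnitDensity φ, balance φ (onesBefore φ 1 * Real.exp (-1)) x =
        (1 - onesBefore φ 1) * (onesBefore φ 1 * Real.exp (-1)) := by
    intro φ hφ hφ01 hp0 hp1 he
    have hq := (quadratic_le_and_eq hp0 (sub_pos.mpr hp1) (continuous_onesBefore hφ hφ01).measurable
      (continuous_zerosAfter hφ hφ01).measurable (map_onesBefore hφ hφ01)
      (ae_zerosAfter_mem hφ hφ01)).2
    rw [patternDensity_word1010_eq_quadratic hφ hφ01] at he
    exact (hq (by linarith)).mono fun x hx =>
      (zerosAfter_eq_cutProfile_iff (by positivity) x).mp hx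
  have hbg : ∀ᵐ x ∂withUnitDensity g, balance g (onesBefore f 1 * Real.exp (-1)) x =
      (1 - onesBefore g 1) * (onesBefore f 1 * Real.exp (-1)) := by
    rw [hfg] at h0 hA1 ⊢
    exact key hg hg01 h0 hA1 h2
  exact onesBefore_eq_of_ae_balance_eq hf hf01 hg hg01 hfg hk hkA hA1
    (key hf hf01 h0 hA1 h1) hbg hx

end Uniqueness

/-! ### The optimal density -/

section Optimal

variable {ρ : ℝ}

theorem measurable_optimalDensity (ρ : ℝ) : Measurable (optimalDensity ρ) := by
  unfold optimalDensity
  refine Measurable.ite measurableSet_Iio measurable_const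
    (Measurable.ite measurableSet_Iic ?_ measurable_const)
  fun_prop

theorem optimalDensity_mem (h0 : 0 ≤ ρ) (h1 : ρ ≤ 1) (x : ℝ) :
    optimalDensity ρ x ∈ Icc (0 : ℝ) 1 := by
  unfold optimalDensity
  split_ifs
  · simp
  · set y := x + ρ - 1
    have hs : |Real.exp (1 / 2) * y / √(4 * ρ * (1 - ρ) + Real.exp 1 * y ^ 2)| ≤ 1 := by
      rw [abs_div, abs_of_nonneg (Real.sqrt_nonneg _)]
      refine div_le_one_of_le₀ (Real.abs_le_sqrt ?_) (Real.sqrt_nonneg _)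
      have : Real.exp (1 / 2) ^ 2 = Real.exp 1 := by
        rw [← Real.exp_nat_mul]; norm_num
      rw [mul_pow, this]
      have : 0 ≤ 1 - ρ := by linarith
      have : 0 ≤ 4 * ρ * (1 - ρ) := by positivity
      linarith
    have := abs_le.mp hs
    constructor <;> linarith [this.1, this.2]
  · simp

/-- The primitive of the optimal density on its middle interval. -/
noncomputable def optimalCurve (ρ x : ℝ) : ℝ :=
  ((x + ρ - 1) + √((x + ρ - 1) ^ 2 + 4 * ρ * (1 - ρ) / Real.exp 1)) / 2

theorem continuous_optimalCurve (ρ : ℝ) : Continuous (optimalCurve ρ) := by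
  unfold optimalCurve
  fun_prop

theorem optimalCurve_left (h0 : 0 ≤ ρ) (h1 : ρ ≤ 1) :
    optimalCurve ρ (ρ / Real.exp 1) = ρ / Real.exp 1 := by
  have he := Real.exp_pos 1
  -- At the breakpoints the discriminant is a perfect square, which makes the pieces of the
  -- primitive join continuously.
  have : (ρ / Real.exp 1 + ρ - 1) ^ 2 + 4 * ρ * (1 - ρ) / Real.exp 1 =
      ((1 - ρ) + ρ / Real.exp 1) ^ 2 := by field_simp; ring
  have h2 : 0 ≤ 1 - ρ := by linarith
  rw [optimalCurve, this, Real.sqrt_sq (by positivity)]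
  ring

theorem optimalCurve_right (h0 : 0 ≤ ρ) (h1 : ρ ≤ 1) :
    optimalCurve ρ (1 - (1 - ρ) / Real.exp 1) = ρ := by
  have he := Real.exp_pos 1
  have : (1 - (1 - ρ) / Real.exp 1 + ρ - 1) ^ 2 + 4 * ρ * (1 - ρ) / Real.exp 1 =
      (ρ + (1 - ρ) / Real.exp 1) ^ 2 := by field_simp; ring
  have h2 : 0 ≤ 1 - ρ := by linarith
  rw [optimalCurve, this, Real.sqrt_sq (by positivity)]
  ring

/-- The balance equation with `k = ρ / e`, in the range where the maximum is the mass of ones;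
`optimalCurve` is the nonnegative root of this quadratic. -/
theorem optimalCurve_mul (h0 : 0 ≤ ρ) (h1 : ρ ≤ 1) (x : ℝ) :
    optimalCurve ρ x * (1 - ρ - (x - optimalCurve ρ x)) = (1 - ρ) * (ρ / Real.exp 1) := by
  have h2 : 0 ≤ 1 - ρ := by linarith
  have hs := Real.sq_sqrt (show 0 ≤ (x + ρ - 1) ^ 2 + 4 * ρ * (1 - ρ) / Real.exp 1 by positivity)
  unfold optimalCurve
  linear_combination hs / 4

theorem hasDerivAt_optimalCurve (h0 : 0 ≤ ρ) (h1 : ρ ≤ 1) {x : ℝ}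
    (hx : x ∈ Ioo (ρ / Real.exp 1) (1 - (1 - ρ) / Real.exp 1)) :
    HasDerivAt (optimalCurve ρ) (optimalDensity ρ x) x := by
  have he := Real.exp_pos 1
  have h2 : 0 ≤ 1 - ρ := by linarith
  -- For `ρ` equal to 0 or 1 the constant term vanishes, and positivity comes from the square,
  -- nonzero inside the open interval.
  have hpos : 0 < (x + ρ - 1) ^ 2 + 4 * ρ * (1 - ρ) / Real.exp 1 := by
    rcases h0.eq_or_lt with h | h
    · subst h
      have : x - 1 < 0 := by
        have := hx.2
        have h3 : 0 < (1 - 0) / Real.exp 1 := by positivity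
        linarith
      simp only [add_zero, mul_zero, zero_mul, zero_div]
      exact sq_pos_of_neg this
    · rcases h1.eq_or_lt with h' | h'
      · subst h'
        have : 0 < x := (div_pos one_pos he).trans hx.1
        have : 0 < (x + 1 - 1) ^ 2 := by simpa using pow_pos this 2
        positivity
      · have : 0 < 1 - ρ := by linarith
        positivity
  have hd : HasDerivAt (optimalCurve ρ)
      ((1 + (2 * (x + ρ - 1)) / (2 * √((x + ρ - 1) ^ 2 + 4 * ρ * (1 - ρ) / Real.exp 1))) / 2) x := by
    have hy : HasDerivAt (fun x : ℝ => x + ρ - 1) 1 x :=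
      ((hasDerivAt_id x).add_const ρ).sub_const 1
    have hsq := ((hy.pow 2).add_const (4 * ρ * (1 - ρ) / Real.exp 1)).sqrt hpos.ne'
    have := (hy.add hsq).div_const 2
    refine HasDerivAt.congr_deriv (f := optimalCurve ρ) this ?_
    simp
  convert hd using 1
  rw [optimalDensity, if_neg (not_lt.mpr hx.1.le), if_pos hx.2.le]
  have hexp : Real.exp (1 / 2) = √(Real.exp 1) := by rw [Real.exp_half]
  have : 4 * ρ * (1 - ρ) + Real.exp 1 * (x + ρ - 1) ^ 2 =
      Real.exp 1 * ((x + ρ - 1) ^ 2 + 4 * ρ * (1 - ρ) / Real.exp 1) := by field_simp; ring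
  rw [this, Real.sqrt_mul he.le, hexp]
  have := Real.sqrt_pos.mpr he
  have := Real.sqrt_pos.mpr hpos
  field_simp

theorem optimal_breakpoints (h0 : 0 ≤ ρ) (h1 : ρ ≤ 1) :
    0 ≤ ρ / Real.exp 1 ∧ ρ / Real.exp 1 ≤ 1 - (1 - ρ) / Real.exp 1 ∧
      1 - (1 - ρ) / Real.exp 1 ≤ 1 := by
  have he := Real.exp_pos 1
  have h2 : 0 ≤ 1 - ρ := by linarith
  refine ⟨by positivity, ?_, ?_⟩
  · have h3 : ρ / Real.exp 1 + (1 - ρ) / Real.exp 1 = 1 / Real.exp 1 := by ring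
    have : 1 / Real.exp 1 ≤ 1 := by
      rw [div_le_one he]; exact Real.one_le_exp zero_le_one
    linarith
  · rw [sub_le_self_iff]; positivity

theorem onesBefore_optimal_left (h0 : 0 ≤ ρ) (h1 : ρ ≤ 1) {x : ℝ}
    (hx : x ∈ Icc 0 (ρ / Real.exp 1)) : onesBefore (optimalDensity ρ) x = x := by
  have h := intervalIntegral.integral_eq_sub_of_hasDeriv_right_of_le (f := fun x => x) hx.1
    continuousOn_id (f' := optimalDensity ρ) (fun y hy => by
      rw [optimalDensity, if_pos (hy.2.trans_le hx.2)]
      exact (hasDerivAt_id y).hasDerivWithinAt)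
    (intervalIntegrable_of_mem_Icc (measurable_optimalDensity ρ) (optimalDensity_mem h0 h1) _ _)
  rw [onesBefore, h, sub_zero]

theorem onesBefore_optimal_middle (h0 : 0 ≤ ρ) (h1 : ρ ≤ 1) {x : ℝ}
    (hx : x ∈ Icc (ρ / Real.exp 1) (1 - (1 - ρ) / Real.exp 1)) :
    onesBefore (optimalDensity ρ) x = optimalCurve ρ x := by
  have h := intervalIntegral.integral_eq_sub_of_hasDeriv_right_of_le hx.1
    (continuous_optimalCurve ρ).continuousOn (f' := optimalDensity ρ) (fun y hy =>
      (hasDerivAt_optimalCurve h0 h1 ⟨hy.1, hy.2.trans_le hx.2⟩).hasDerivWithinAt)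
    (intervalIntegrable_of_mem_Icc (measurable_optimalDensity ρ) (optimalDensity_mem h0 h1) _ _)
  rw [← onesBefore_sub (measurable_optimalDensity ρ) (optimalDensity_mem h0 h1),
    onesBefore_optimal_left h0 h1 ⟨(optimal_breakpoints h0 h1).1, le_rfl⟩,
    optimalCurve_left h0 h1] at h
  linarith

theorem onesBefore_optimal_right (h0 : 0 ≤ ρ) (h1 : ρ ≤ 1) {x : ℝ}
    (hx : 1 - (1 - ρ) / Real.exp 1 ≤ x) :
    onesBefore (optimalDensity ρ) x = ρ := by
  have hb := optimal_breakpoints h0 h1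
  have h := intervalIntegral.integral_eq_sub_of_hasDeriv_right_of_le hx
    (f := fun _ => (0 : ℝ)) continuousOn_const (f' := optimalDensity ρ) (fun y hy => by
      rw [optimalDensity, if_neg (not_lt.mpr (hb.2.1.trans hy.1.le)), if_neg (not_le.mpr hy.1)]
      exact (hasDerivAt_const y (0 : ℝ)).hasDerivWithinAt)
    (intervalIntegrable_of_mem_Icc (measurable_optimalDensity ρ) (optimalDensity_mem h0 h1) _ _)
  rw [← onesBefore_sub (measurable_optimalDensity ρ) (optimalDensity_mem h0 h1),
    onesBefore_optimal_middle h0 h1 ⟨hb.2.1, le_rfl⟩, optimalCurve_right h0 h1] at h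
  linarith

theorem onesBefore_optimal_one (h0 : 0 ≤ ρ) (h1 : ρ ≤ 1) :
    onesBefore (optimalDensity ρ) 1 = ρ :=
  onesBefore_optimal_right h0 h1 (optimal_breakpoints h0 h1).2.2

theorem balance_optimalDensity (h0 : 0 ≤ ρ) (h1 : ρ ≤ 1) {x : ℝ}
    (hx : x ∈ Icc 0 (1 - (1 - ρ) / Real.exp 1)) :
    balance (optimalDensity ρ) (ρ / Real.exp 1) x = (1 - ρ) * (ρ / Real.exp 1) := by
  rw [balance, zerosAfter, onesBefore_optimal_one h0 h1]
  rcases le_total x (ρ / Real.exp 1) with h | h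
  · rw [onesBefore_optimal_left h0 h1 ⟨hx.1, h⟩, max_eq_right h]; ring
  · have hle := onesBefore_mono (measurable_optimalDensity ρ) (optimalDensity_mem h0 h1) h
    rw [onesBefore_optimal_left h0 h1 ⟨(optimal_breakpoints h0 h1).1, le_rfl⟩] at hle
    rw [max_eq_left hle, onesBefore_optimal_middle h0 h1 ⟨h, hx.2⟩, optimalCurve_mul h0 h1]

theorem patternDensity_optimal (h0 : 0 ≤ ρ) (h1 : ρ ≤ 1) :
    patternDensity word1010 (withUnitDensity (optimalDensity ρ)) =
      12 * (ρ * (1 - ρ) * Real.exp (-1)) ^ 2 := by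
  have hm := measurable_optimalDensity ρ
  have h01 := optimalDensity_mem h0 h1
  have hone := onesBefore_optimal_one h0 h1
  rcases h0.eq_or_lt with h | h
  · rw [patternDensity_word1010_of_degenerate hm h01 (Or.inl (hone.trans h.symm)), ← h]; simp
  rcases h1.eq_or_lt with h' | h'
  · rw [patternDensity_word1010_of_degenerate hm h01 (Or.inr (hone.trans h')), h']; simp
  have hk : ρ / Real.exp 1 = ρ * Real.exp (-1) := by rw [Real.exp_neg, div_eq_mul_inv]
  have hae : ∀ᵐ x ∂withUnitDensity (optimalDensity ρ), zerosAfter (optimalDensity ρ) x =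
      cutProfile (1 - ρ) (ρ * Real.exp (-1)) (onesBefore (optimalDensity ρ) x) := by
    -- The balance identity is available only up to the last breakpoint; beyond it the measure has
    -- no mass.
    have : ∀ᵐ x ∂withUnitDensity (optimalDensity ρ), x ≤ 1 - (1 - ρ) / Real.exp 1 := by
      refine (ae_withDensity_iff hm.ennreal_ofReal).mpr (ae_of_all _ fun x hx => ?_)
      by_contra hlt
      apply hx
      have hb := optimal_breakpoints h0 h1
      rw [not_le] at hlt
      rw [optimalDensity, if_neg (not_lt.mpr (hb.2.1.trans hlt.le)), if_neg (not_le.mpr hlt),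
        ENNReal.ofReal_zero]
    filter_upwards [this, ae_withUnitDensity_mem] with x hx hx01
    rw [zerosAfter_eq_cutProfile_iff (by positivity), ← hk]
    exact balance_optimalDensity h0 h1 ⟨hx01.1, hx⟩
  have hmap := map_onesBefore hm h01
  rw [hone] at hmap
  have := quadratic_eq_of_eq h (continuous_onesBefore hm h01).measurable hmap hae
  rw [patternDensity_word1010_eq_quadratic hm h01, this]
  ring

end Optimal

/-! ### The continuous extremal theorem -/

theorem exists_unique_optimal_sublebesgue {ρ : ℝ} (h0 : 0 ≤ ρ) (h1 : ρ ≤ 1) :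
    IsGreatest (patternDensity word1010 '' sublebesgueWithMass ρ)
      (12 / Real.exp 1 ^ 2 * ρ ^ 2 * (1 - ρ) ^ 2) ∧
    ∃ μ ∈ sublebesgueWithMass ρ,
      patternDensity word1010 μ = 12 / Real.exp 1 ^ 2 * ρ ^ 2 * (1 - ρ) ^ 2 ∧
      unitDensity μ =ᵐ[lebesgueUnit] optimalDensity ρ ∧
      ∀ ν ∈ sublebesgueWithMass ρ,
        patternDensity word1010 ν = 12 / Real.exp 1 ^ 2 * ρ ^ 2 * (1 - ρ) ^ 2 → ν = μ := by
  have hm := measurable_optimalDensity ρ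
  have h01 := optimalDensity_mem h0 h1
  have hone := onesBefore_optimal_one h0 h1
  have hval : 12 / Real.exp 1 ^ 2 * ρ ^ 2 * (1 - ρ) ^ 2 =
      12 * (ρ * (1 - ρ) * Real.exp (-1)) ^ 2 := by
    rw [Real.exp_neg]; field_simp
  have hmem : withUnitDensity (optimalDensity ρ) ∈ sublebesgueWithMass ρ :=
    ⟨⟨_, hm, h01, rfl⟩, (patternDensity_word1 hm h01).trans hone⟩
  rw [hval]
  refine ⟨⟨⟨_, hmem, patternDensity_optimal h0 h1⟩, ?_⟩, _, hmem, patternDensity_optimal h0 h1,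
    unitDensity_withUnitDensity hm h01, ?_⟩
  · rintro _ ⟨ν, ⟨⟨f, hf, hf01, rfl⟩, hν⟩, rfl⟩
    have hA : onesBefore f 1 = ρ := (patternDensity_word1 hf hf01).symm.trans hν
    rw [← hA]
    exact patternDensity_word1010_le hf hf01
  · rintro ν ⟨⟨f, hf, hf01, rfl⟩, hν⟩ hν2
    have hA : onesBefore f 1 = ρ := (patternDensity_word1 hf hf01).symm.trans hν
    refine withUnitDensity_unique hf hf01 hm h01 (hA.trans hone.symm) ?_ ?_
    · rw [hA]; exact hν2
    · rw [hone]; exact patternDensity_optimal h0 h1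

/-! ### Counting the pattern `1010` -/

/-- An occurrence of a word of length four is an increasing quadruple of positions. -/
def occurrenceEquiv {N : ℕ} (X : Fin N → Bool) :
    {e : Fin 4 ↪o Fin N // ∀ i, X (e i) = word1010 i} ≃
    {q : Fin N × Fin N × Fin N × Fin N //
      (q.2.2.2 < q.2.2.1 ∧ q.2.2.1 < q.2.1 ∧ q.2.1 < q.1) ∧
      (X q.2.2.2 = true ∧ X q.2.2.1 = false ∧ X q.2.1 = true ∧ X q.1 = false)} where
  toFun e := ⟨(e.1 3, e.1 2, e.1 1, e.1 0),
    ⟨e.1.strictMono (by decide), e.1.strictMono (by decide), e.1.strictMono (by decide)⟩,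
    e.2 0, e.2 1, e.2 2, e.2 3⟩
  invFun q := ⟨OrderEmbedding.ofStrictMono ![q.1.2.2.2, q.1.2.2.1, q.1.2.1, q.1.1] (by
      rw [Fin.strictMono_iff_lt_succ]
      intro i
      fin_cases i
      · exact q.2.1.1
      · exact q.2.1.2.1
      · exact q.2.1.2.2), by
      intro i
      fin_cases i
      · exact q.2.2.1
      · exact q.2.2.2.1
      · exact q.2.2.2.2.1
      · exact q.2.2.2.2.2⟩
  left_inv e := by
    ext i
    fin_cases i <;> rfl
  right_inv q := rfl

theorem sum_fin_lt_eq_sum_range {N m : ℕ} (hm : m ≤ N) (g : ℕ → ℝ) :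
    ∑ i : Fin N, (if (i : ℕ) < m then g i else 0) = ∑ i ∈ Finset.range m, g i := by
  rw [Fin.sum_univ_eq_sum_range (fun i => if i < m then g i else 0) N, ← Finset.sum_filter]
  congr 1
  ext i
  simp only [Finset.mem_filter, Finset.mem_range]
  omega

theorem patternCount_word1010 {N : ℕ} (X : Fin N → Bool) {x : ℕ → ℝ}
    (hx : ∀ k : Fin N, x k = if X k = true then 1 else 0) :
    (patternCount word1010 X : ℝ) = ∑ l ∈ Finset.range N, (1 - x l) * ∑ k ∈ Finset.range l,
      x k * ∑ j ∈ Finset.range k, (1 - x j) * ∑ i ∈ Finset.range j, x i := by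
  rw [patternCount, Nat.card_congr (occurrenceEquiv X), Nat.card_eq_fintype_card,
    Fintype.card_subtype, Finset.card_filter]
  push_cast
  rw [← Fin.sum_univ_eq_sum_range (fun l => (1 - x l) * ∑ k ∈ Finset.range l,
      x k * ∑ j ∈ Finset.range k, (1 - x j) * ∑ i ∈ Finset.range j, x i) N,
    Fintype.sum_prod_type]
  refine Finset.sum_congr rfl fun l _ => ?_
  rw [← sum_fin_lt_eq_sum_range l.2.le, Fintype.sum_prod_type, Finset.mul_sum]
  refine Finset.sum_congr rfl fun k _ => ?_
  by_cases hkl : (k : ℕ) < l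
  swap
  · rw [if_neg hkl, mul_zero]
    refine Finset.sum_eq_zero fun p _ => if_neg fun h => hkl h.1.2.2
  rw [if_pos hkl, ← sum_fin_lt_eq_sum_range k.2.le, Fintype.sum_prod_type, Finset.mul_sum,
    Finset.mul_sum]
  refine Finset.sum_congr rfl fun j _ => ?_
  by_cases hjk : (j : ℕ) < k
  swap
  · rw [if_neg hjk, mul_zero, mul_zero]
    refine Finset.sum_eq_zero fun p _ => if_neg fun h => hjk h.1.2.1
  rw [if_pos hjk, ← sum_fin_lt_eq_sum_range j.2.le, Finset.mul_sum, Finset.mul_sum, Finset.mul_sum]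
  refine Finset.sum_congr rfl fun i _ => ?_
  have hij : (i < j) ↔ ((i : ℕ) < j) := Iff.rfl
  have hjk' : j < k := hjk
  have hkl' : k < l := hkl
  simp only [hx, hij, hjk', hkl', and_true]
  by_cases h : (i : ℕ) < j <;> cases X i <;> cases X j <;> cases X k <;> cases X l <;> simp [h]

/-- Summation by parts in place of integration by parts. Diagonal terms no longer vanish, but `hx`
reduces them: squaring `∑ x k * c k` leaves the diagonal `∑ x k * c k ^ 2`, half of which turns `a
k` into `a k + 1 / 2`. -/
theorem pattern_sum_eq_quadratic {x : ℕ → ℝ} (hx : ∀ k, x k * x k = x k) (N : ℕ) {a c : ℕ → ℝ}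
    (ha : ∀ m, a m = ∑ i ∈ Finset.range m, x i) (hc : ∀ m, c m = (N - a N) - (m - a m)) :
    ∑ l ∈ Finset.range N, (1 - x l) * ∑ k ∈ Finset.range l,
      x k * ∑ j ∈ Finset.range k, (1 - x j) * ∑ i ∈ Finset.range j, x i =
    (∑ k ∈ Finset.range N, x k * c k) ^ 2 / 2 -
      ∑ k ∈ Finset.range N, x k * ((a k + 1 / 2) * c k ^ 2) := by
  have ha0 : a 0 = 0 := by rw [ha]; simp
  have has : ∀ m, a (m + 1) = a m + x m := fun m => by rw [ha, ha, Finset.sum_range_succ]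
  have hcs : ∀ m, c (m + 1) = c m - (1 - x m) := fun m => by
    rw [hc, hc, has]; push_cast; ring
  have hG : ∀ k, ∑ j ∈ Finset.range k, (1 - x j) * ∑ i ∈ Finset.range j, x i =
      ∑ j ∈ Finset.range k, x j * c j - a k * c k := by
    intro k
    induction k with
    | zero => simp [ha0]
    | succ k ih =>
      rw [Finset.sum_range_succ, ih, Finset.sum_range_succ, ← ha, has, hcs]
      linear_combination hx k
  set G : ℕ → ℝ := fun k => ∑ j ∈ Finset.range k, x j * c j - a k * c k with hGdef
  have hH : ∀ m, ∑ l ∈ Finset.range m, (1 - x l) * ∑ k ∈ Finset.range l, x k * G k =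
      (m - a m) * (∑ k ∈ Finset.range m, x k * G k) -
        ∑ k ∈ Finset.range m, x k * G k * (k - a k) := by
    intro m
    induction m with
    | zero => simp
    | succ m ih =>
      rw [Finset.sum_range_succ, ih, Finset.sum_range_succ, Finset.sum_range_succ, has]
      push_cast
      linear_combination G m * hx m
  have hU : ∀ m, ∑ k ∈ Finset.range m, x k * c k * ∑ j ∈ Finset.range k, x j * c j =
      ((∑ k ∈ Finset.range m, x k * c k) ^ 2 - ∑ k ∈ Finset.range m, x k * c k ^ 2) / 2 := by
    intro m
    induction m with
    | zero => simp
    | succ m ih =>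
      rw [Finset.sum_range_succ, ih, Finset.sum_range_succ, Finset.sum_range_succ]
      linear_combination (-(c m ^ 2) / 2) * hx m
  simp only [hG]
  rw [hH N]
  have e1 : ∑ k ∈ Finset.range N, x k * ((a k + 1 / 2) * c k ^ 2) =
      ∑ k ∈ Finset.range N, x k * c k * (a k * c k) +
        (∑ k ∈ Finset.range N, x k * c k ^ 2) / 2 := by
    rw [Finset.sum_div, ← Finset.sum_add_distrib]
    exact Finset.sum_congr rfl fun k _ => by ring
  have e2 : (N - a N) * (∑ k ∈ Finset.range N, x k * G k) -
      ∑ k ∈ Finset.range N, x k * G k * (k - a k) =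
      ∑ k ∈ Finset.range N, x k * c k * ∑ j ∈ Finset.range k, x j * c j -
        ∑ k ∈ Finset.range N, x k * c k * (a k * c k) := by
    rw [Finset.mul_sum, ← Finset.sum_sub_distrib, ← Finset.sum_sub_distrib]
    refine Finset.sum_congr rfl fun k _ => ?_
    simp only [hGdef]
    linear_combination (-(x k * (∑ j ∈ Finset.range k, x j * c j - a k * c k))) * hc k
  rw [e2, hU, e1]
  ring

/-- The number of occurrences of `1010` in terms of the numbers `C i` of zeros after the `i`-th
one. -/
theorem patternCount_word1010_eq {n : ℕ} (X : Fin (2 * n) → Bool) (e : Fin n ↪o Fin (2 * n))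
    (hX : ∀ k, X k = true ↔ ∃ i, e i = k) {C : ℕ → ℝ}
    (hC : ∀ i : Fin n, C i = n + i - (e i : ℕ)) :
    (patternCount word1010 X : ℝ) =
      (∑ i ∈ Finset.range n, C i) ^ 2 / 2 - ∑ i ∈ Finset.range n, (i + 1 / 2) * C i ^ 2 := by
  -- The indicator of the positions of ones, written as a sum over the ones so that sums over
  -- positions become sums over ones.
  set x : ℕ → ℝ := fun m => ∑ j : Fin n, if (e j : ℕ) = m then 1 else 0 with hx
  have hxX : ∀ k : Fin (2 * n), x k = if X k = true then 1 else 0 := by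
    intro k
    by_cases h : X k = true
    · obtain ⟨i, hi⟩ := (hX k).mp h
      rw [if_pos h, hx]
      simp only
      rw [Finset.sum_eq_single i (fun j _ hj => if_neg fun hjk => hj (e.injective
        ((Fin.ext hjk).trans hi.symm))) (by simp), if_pos (by rw [hi])]
    · rw [if_neg h, hx]
      exact Finset.sum_eq_zero fun j _ => if_neg fun hjk => h ((hX k).mpr ⟨j, Fin.ext hjk⟩)
  have hxx : ∀ k, x k * x k = x k := by
    intro k
    by_cases hk : k < 2 * n
    · rw [show x k = _ from hxX ⟨k, hk⟩]; split_ifs <;> simp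
    · have : x k = 0 := Finset.sum_eq_zero fun j _ => if_neg fun h => hk (by
        rw [← h]; exact (e j).2)
      simp [this]
  have hsum : ∀ (m : ℕ) (ψ : ℕ → ℝ), ∑ k ∈ Finset.range m, x k * ψ k =
      ∑ j : Fin n, if (e j : ℕ) < m then ψ (e j) else 0 := by
    intro m ψ
    simp only [hx, Finset.sum_mul]
    rw [Finset.sum_comm]
    refine Finset.sum_congr rfl fun j _ => ?_
    simp only [ite_mul, one_mul, zero_mul, Finset.sum_ite_eq, Finset.mem_range]
  have hsumN : ∀ ψ : ℕ → ℝ, ∑ k ∈ Finset.range (2 * n), x k * ψ k = ∑ j : Fin n, ψ (e j) := by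
    intro ψ
    rw [hsum]
    exact Finset.sum_congr rfl fun j _ => if_pos (e j).2
  set a : ℕ → ℝ := fun m => ∑ i ∈ Finset.range m, x i with ha
  have hae : ∀ i : Fin n, a (e i) = i := by
    intro i
    have h := hsum (e i) fun _ => 1
    simp only [mul_one] at h
    rw [ha]
    simp only
    rw [h]
    have : ∀ j : Fin n, ((e j : ℕ) < e i) = ((j : ℕ) < i) := fun j =>
      propext (e.lt_iff_lt (a := j) (b := i))
    simp only [this]
    rw [sum_fin_lt_eq_sum_range i.2.le fun _ => 1]
    simp
  have haN : a (2 * n) = n := by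
    have h := hsumN fun _ => 1
    simp only [mul_one] at h
    rw [ha]
    simp only
    rw [h]
    simp
  have hce : ∀ i : Fin n, ((2 * n : ℕ) - a (2 * n)) - ((e i : ℕ) - a (e i)) = C i := by
    intro i
    rw [hae, haN, hC]
    push_cast
    ring
  rw [patternCount_word1010 X hxX, pattern_sum_eq_quadratic hxx (2 * n) (a := a)
    (c := fun m => ((2 * n : ℕ) - a (2 * n)) - (m - a m)) (fun _ => rfl) (fun _ => rfl),
    hsumN, hsumN]
  simp only [hce]
  simp only [hae]
  rw [Fin.sum_univ_eq_sum_range C, Fin.sum_univ_eq_sum_range fun i => ((i : ℝ) + 1 / 2) * C i ^ 2]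

/-! ### The extremal problem for decks -/

theorem integral_mul_natFloor {w : ℝ → ℝ} (hw : Continuous w) (φ : ℕ → ℝ) (n : ℕ) :
    ∫ s in (0 : ℝ)..n, w s * φ ⌊s⌋₊ =
      ∑ i ∈ Finset.range n, (∫ s in (i : ℝ)..(i + 1 : ℕ), w s) * φ i := by
  have hae : ∀ i : ℕ, (fun s => w s * φ i) =ᵐ[volume.restrict (uIoc (i : ℝ) (i + 1 : ℕ))]
      fun s => w s * φ ⌊s⌋₊ := by
    intro i
    have hle : (i : ℝ) ≤ (i + 1 : ℕ) := by push_cast; linarith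
    rw [uIoc_of_le hle, Filter.EventuallyEq, ae_restrict_iff' measurableSet_Ioc]
    filter_upwards [Measure.ae_ne volume ((i + 1 : ℕ) : ℝ)] with s hs hsi
    have : ⌊s⌋₊ = i := by
      rw [Nat.floor_eq_iff ((Nat.cast_nonneg i).trans hsi.1.le)]
      refine ⟨hsi.1.le, ?_⟩
      have := lt_of_le_of_ne hsi.2 hs
      push_cast at this
      exact this
    rw [this]
  have hint : ∀ i : ℕ, IntervalIntegrable (fun s => w s * φ ⌊s⌋₊) volume i (i + 1 : ℕ) :=
    fun i => ((hw.intervalIntegrable _ _).mul_const (φ i)).congr_ae (hae i)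
  have h := intervalIntegral.sum_integral_adjacent_intervals (a := fun i : ℕ => (i : ℝ)) (n := n)
    (f := fun s => w s * φ ⌊s⌋₊) (μ := volume) fun k _ => hint k
  simp only [Nat.cast_zero] at h
  rw [← h]
  refine Finset.sum_congr rfl fun i _ => ?_
  rw [← intervalIntegral.integral_mul_const]
  exact (intervalIntegral.integral_congr_ae_restrict (hae i)).symm

theorem integral_natFloor (φ : ℕ → ℝ) (n : ℕ) :
    ∫ s in (0 : ℝ)..n, φ ⌊s⌋₊ = ∑ i ∈ Finset.range n, φ i := by
  have h := integral_mul_natFloor (w := fun _ => 1) continuous_const φ n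
  simpa using h

/-- The mean of `s` over the cell from `i` to `i + 1` is `i + 1 / 2`, precisely the discrete
coefficient; this is why the bound for decks carries no error term. -/
theorem integral_id_mul_natFloor (φ : ℕ → ℝ) (n : ℕ) :
    ∫ s in (0 : ℝ)..n, s * φ ⌊s⌋₊ = ∑ i ∈ Finset.range n, (i + 1 / 2) * φ i := by
  rw [integral_mul_natFloor (w := fun s => s) continuous_id φ n]
  refine Finset.sum_congr rfl fun i _ => ?_
  simp only [integral_id]
  push_cast
  ring

theorem le_orderEmbedding_apply {n m : ℕ} (e : Fin n ↪o Fin m) (i : Fin n) :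
    (i : ℕ) ≤ e i := by
  obtain ⟨i, hi⟩ := i
  induction i with
  | zero => exact Nat.zero_le _
  | succ i ih =>
    have h := ih (by omega)
    have h2 : e ⟨i, by omega⟩ < e ⟨i + 1, hi⟩ := e.strictMono (Fin.mk_lt_mk.mpr (Nat.lt_succ_self i))
    have h3 : (e ⟨i, by omega⟩ : ℕ) < e ⟨i + 1, hi⟩ := h2
    simp only at h ⊢
    omega

theorem orderEmbedding_apply_add_le {n m : ℕ} (e : Fin n ↪o Fin m) (i : Fin n) :
    (e i : ℕ) + n ≤ m + i := by
  -- The lower bound on positions is applied to the embedding reversed at both ends.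
  have h : (i.rev : ℕ) ≤ (e i.rev.rev).rev := le_orderEmbedding_apply (OrderEmbedding.ofStrictMono (fun j => (e j.rev).rev)
    fun _ _ hij => Fin.rev_lt_rev.mpr (e.strictMono (Fin.rev_lt_rev.mpr hij))) i.rev
  have h1 := (e i).2
  have h2 := i.2
  rw [Fin.rev_rev, Fin.val_rev, Fin.val_rev] at h
  omega

theorem patternCount_word1010_le {n : ℕ} (hn : 0 < n) (X : Fin (2 * n) → Bool)
    (hX : (Finset.univ.filter fun i => X i = true).card = n) :
    (patternCount word1010 X : ℝ) ≤ ((n : ℝ) * n * Real.exp (-1)) ^ 2 / 2 := by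
  set e := (Finset.univ.filter fun i => X i = true).orderEmbOfFin hX with he
  have hXe : ∀ k, X k = true ↔ ∃ i, e i = k := by
    intro k
    have := Finset.range_orderEmbOfFin (Finset.univ.filter fun i => X i = true) hX
    rw [Set.ext_iff] at this
    have := this k
    simp only [Finset.coe_filter, Finset.mem_univ, true_and, Set.mem_ofPred_eq, mem_range] at this
    exact this.symm
  set C : ℕ → ℝ := fun i => if h : i < n then n + i - (e ⟨i, h⟩ : ℕ) else 0 with hC
  have hCe : ∀ i : Fin n, C i = n + i - (e i : ℕ) := fun i => by
    rw [hC]; simp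
  have hCmem : ∀ i, C i ∈ Icc (0 : ℝ) n := by
    intro i
    by_cases h : i < n
    · rw [show C i = _ from hCe ⟨i, h⟩]
      have h1 := le_orderEmbedding_apply e ⟨i, h⟩
      have h2 := orderEmbedding_apply_add_le e ⟨i, h⟩
      simp only at h1 h2 ⊢
      have h2' : (e ⟨i, h⟩ : ℕ) ≤ n + i := by omega
      have h1r : (i : ℝ) ≤ (e ⟨i, h⟩ : ℕ) := by exact_mod_cast h1
      have h2r : ((e ⟨i, h⟩ : ℕ) : ℝ) ≤ n + i := by exact_mod_cast h2'
      constructor <;> linarith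
    · simp [hC, h]
  have hn' : (0 : ℝ) < n := by exact_mod_cast hn
  -- The abstract problem with `A = B = n`, where `a` is the identity and `c` the step function with
  -- values `C i`.
  have hq := (quadratic_le_and_eq (μ := volume.restrict (Icc (0 : ℝ) n)) (a := fun s => s)
    (c := fun s => C ⌊s⌋₊) hn' hn' measurable_id
    ((measurable_from_nat (f := C)).comp Nat.measurable_floor) Measure.map_id
    (ae_of_all _ fun s => hCmem _)).1
  rw [integral_Icc_eq_integral_Ioc, integral_Icc_eq_integral_Ioc,
    ← intervalIntegral.integral_of_le hn'.le, ← intervalIntegral.integral_of_le hn'.le,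
    integral_natFloor, integral_id_mul_natFloor fun i => C i ^ 2] at hq
  rw [patternCount_word1010_eq X e hXe hCe]
  exact hq

/-- The numbers of zeros after the successive ones in an asymptotically optimal deck. -/
noncomputable def deckZeros (n i : ℕ) : ℕ :=
  ⌊(n : ℝ) * cutProfile 1 (Real.exp (-1)) (i / n)⌋₊

theorem cutProfile_antitone {k : ℝ} (hk : 0 < k) : Antitone (cutProfile 1 k) := by
  intro s t hst
  unfold cutProfile
  have h1 : 0 < max s k := lt_max_of_lt_right hk
  gcongr

theorem deckZeros_le (n i : ℕ) : deckZeros n i ≤ n := by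
  have := (cutProfile_mem_Icc zero_le_one (Real.exp_pos (-1)) ((i : ℝ) / n)).2
  refine Nat.floor_le_of_le ?_
  exact mul_le_of_le_one_right (Nat.cast_nonneg n) this

theorem deckZeros_antitone (n : ℕ) : Antitone (deckZeros n) := by
  intro i j hij
  refine Nat.floor_le_floor (mul_le_mul_of_nonneg_left ?_ (Nat.cast_nonneg n))
  exact cutProfile_antitone (Real.exp_pos _) (by gcongr)

/-- A one preceded by `i` ones and followed by `deckZeros n i` of the `n` zeros must sit at position
`n + i - deckZeros n i`. These positions increase strictly because `deckZeros n` is antitone. -/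
theorem exists_deck (n : ℕ) : ∃ X : Fin (2 * n) → Bool,
    (Finset.univ.filter fun i => X i = true).card = n ∧
    (patternCount word1010 X : ℝ) = (∑ i ∈ Finset.range n, (deckZeros n i : ℝ)) ^ 2 / 2 -
      ∑ i ∈ Finset.range n, (i + 1 / 2) * (deckZeros n i : ℝ) ^ 2 := by
  set e : Fin n ↪o Fin (2 * n) := OrderEmbedding.ofStrictMono
    (fun i => ⟨n + i - deckZeros n i, by have := i.2; omega⟩) (fun i j hij => by
      have h1 := deckZeros_antitone n (show (i : ℕ) ≤ j from hij.le)
      have h2 := deckZeros_le n i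
      have h3 : (i : ℕ) < j := hij
      rw [Fin.mk_lt_mk]
      omega) with he
  refine ⟨fun k => decide (∃ i, e i = k), ?_, ?_⟩
  · have : (Finset.univ.filter fun k => decide (∃ i, e i = k) = true) =
        Finset.univ.image e := by
      ext k; simp
    rw [this, Finset.card_image_of_injective _ e.injective, Finset.card_univ, Fintype.card_fin]
  · refine patternCount_word1010_eq _ e (fun k => by simp) (C := fun i => (deckZeros n i : ℝ))
      fun i => ?_
    have h2 := deckZeros_le n i
    have : ((e i : ℕ) : ℝ) = n + i - deckZeros n i := by
      rw [show (e i : ℕ) = n + i - deckZeros n i from rfl, Nat.cast_sub (by omega)]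
      push_cast
      ring
    rw [this]
    ring

/-! ### Asymptotics of the constructed decks -/

theorem tendsto_deckZeros {s : ℝ} (hs : 0 ≤ s) :
    Tendsto (fun n : ℕ => (deckZeros n ⌊n * s⌋₊ : ℝ) / n) atTop
      (𝓝 (cutProfile 1 (Real.exp (-1)) s)) := by
  have h1 : Tendsto (fun n : ℕ => ((⌊(n : ℝ) * s⌋₊ : ℝ) / n)) atTop (𝓝 s) := by
    have := (tendsto_nat_floor_mul_div_atTop hs).comp tendsto_natCast_atTop_atTop
    refine this.congr fun n => ?_
    simp [mul_comm]
  have h2 : Tendsto (fun n : ℕ => cutProfile 1 (Real.exp (-1)) ((⌊(n : ℝ) * s⌋₊ : ℝ) / n)) atTop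
      (𝓝 (cutProfile 1 (Real.exp (-1)) s)) :=
    ((continuous_cutProfile (Real.exp_pos _)).tendsto s).comp h1
  have h3 : Tendsto (fun n : ℕ => cutProfile 1 (Real.exp (-1)) ((⌊(n : ℝ) * s⌋₊ : ℝ) / n) -
      1 / (n : ℝ)) atTop (𝓝 (cutProfile 1 (Real.exp (-1)) s)) := by
    simpa using h2.sub tendsto_one_div_atTop_nhds_zero_nat
  refine tendsto_of_tendsto_of_tendsto_of_le_of_le' h3 h2 ?_ ?_
  · filter_upwards [eventually_gt_atTop 0] with n hn
    have hn' : (0 : ℝ) < n := by exact_mod_cast hn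
    rw [le_div_iff₀ hn', sub_mul, one_div, inv_mul_cancel₀ hn'.ne', mul_comm]
    exact (Nat.sub_one_lt_floor _).le
  · filter_upwards [eventually_gt_atTop 0] with n hn
    have hn' : (0 : ℝ) < n := by exact_mod_cast hn
    rw [div_le_iff₀ hn']
    exact (Nat.floor_le (mul_nonneg hn'.le
      (cutProfile_mem_Icc zero_le_one (Real.exp_pos _) _).1)).trans_eq (mul_comm _ _)

/-- After rescaling to `[0, 1]` the functional is evaluated at step functions bounded by 1 that
converge pointwise to the extremal profile, so dominated convergence applies to both integrals. -/
theorem tendsto_deck_quadratic :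
    Tendsto (fun n : ℕ => ((∑ i ∈ Finset.range n, (deckZeros n i : ℝ)) ^ 2 / 2 -
      ∑ i ∈ Finset.range n, (i + 1 / 2) * (deckZeros n i : ℝ) ^ 2) / (n : ℝ) ^ 4) atTop
      (𝓝 (Real.exp (-1) ^ 2 / 2)) := by
  set g := cutProfile 1 (Real.exp (-1)) with hg
  set c : ℕ → ℝ → ℝ := fun n s => (deckZeros n ⌊n * s⌋₊ : ℝ) / n with hc
  have hcm : ∀ n, Measurable (c n) := fun n =>
    ((measurable_from_nat (f := fun i => (deckZeros n i : ℝ))).comp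
      (Nat.measurable_floor.comp (measurable_const.mul measurable_id))).div_const _
  have hc0 : ∀ n s, 0 ≤ c n s := fun n s => by positivity
  have hc1 : ∀ n s, c n s ≤ 1 := fun n s =>
    div_le_one_of_le₀ (by exact_mod_cast deckZeros_le n _) (Nat.cast_nonneg n)
  have hlim : ∀ᵐ s, s ∈ uIoc (0 : ℝ) 1 → Tendsto (fun n => c n s) atTop (𝓝 (g s)) :=
    ae_of_all _ fun s hs => tendsto_deckZeros (by
      rw [uIoc_of_le zero_le_one] at hs; exact hs.1.le)
  have hT : Tendsto (fun n => ∫ s in (0 : ℝ)..1, c n s) atTop (𝓝 (∫ s in (0 : ℝ)..1, g s)) := by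
    refine intervalIntegral.tendsto_integral_filter_of_dominated_convergence (fun _ => 1)
      (Eventually.of_forall fun n => (hcm n).aestronglyMeasurable)
      (Eventually.of_forall fun n => ae_of_all _ fun s _ => ?_) intervalIntegrable_const hlim
    rw [Real.norm_of_nonneg (hc0 n s)]
    exact hc1 n s
  have hQ : Tendsto (fun n => ∫ s in (0 : ℝ)..1, s * c n s ^ 2) atTop
      (𝓝 (∫ s in (0 : ℝ)..1, s * g s ^ 2)) := by
    refine intervalIntegral.tendsto_integral_filter_of_dominated_convergence (fun _ => 1)
      (Eventually.of_forall fun n =>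
        (measurable_id.mul ((hcm n).pow_const 2)).aestronglyMeasurable)
      (Eventually.of_forall fun n => ae_of_all _ fun s hs => ?_) intervalIntegrable_const
      (hlim.mono fun s h hs => ((h hs).pow 2).const_mul s)
    rw [uIoc_of_le zero_le_one] at hs
    rw [Real.norm_of_nonneg (mul_nonneg hs.1.le (sq_nonneg _))]
    exact mul_le_one₀ hs.2 (sq_nonneg _) (pow_le_one₀ (hc0 n s) (hc1 n s))
  have hval : (∫ s in (0 : ℝ)..1, g s) ^ 2 / 2 - ∫ s in (0 : ℝ)..1, s * g s ^ 2 =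
      Real.exp (-1) ^ 2 / 2 := by
    have h := quadratic_eq_of_eq (μ := volume.restrict (Icc (0 : ℝ) 1)) (A := 1) (B := 1)
      (a := fun s => s) (c := g) one_pos measurable_id Measure.map_id
      (ae_of_all _ fun s => by rw [hg, one_mul])
    rw [integral_Icc_eq_integral_Ioc, integral_Icc_eq_integral_Ioc,
      ← intervalIntegral.integral_of_le zero_le_one,
      ← intervalIntegral.integral_of_le zero_le_one] at h
    rw [h]
    ring
  rw [← hval]
  refine (((hT.pow 2).div_const 2).sub hQ).congr' ?_
  filter_upwards [eventually_gt_atTop 0] with n hn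
  have hn' : (n : ℝ) ≠ 0 := by exact_mod_cast hn.ne'
  have e1 : ∫ s in (0 : ℝ)..1, c n s =
      (∑ i ∈ Finset.range n, (deckZeros n i : ℝ)) / (n : ℝ) ^ 2 := by
    have h := intervalIntegral.integral_comp_mul_left (a := 0) (b := 1)
      (fun s => (deckZeros n ⌊s⌋₊ : ℝ) / n) hn'
    rw [mul_zero, mul_one] at h
    rw [hc, h, intervalIntegral.integral_div, integral_natFloor fun i => (deckZeros n i : ℝ),
      smul_eq_mul]
    field_simp
  have e2 : ∫ s in (0 : ℝ)..1, s * c n s ^ 2 =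
      (∑ i ∈ Finset.range n, (i + 1 / 2) * (deckZeros n i : ℝ) ^ 2) / (n : ℝ) ^ 4 := by
    have h := intervalIntegral.integral_comp_mul_left (a := 0) (b := 1)
      (fun s => s * (deckZeros n ⌊s⌋₊ : ℝ) ^ 2) hn'
    rw [mul_zero, mul_one, integral_id_mul_natFloor fun i => (deckZeros n i : ℝ) ^ 2] at h
    -- One power of `n` comes from rescaling `s` and two from `c n s ^ 2`; the change of variables
    -- supplies the fourth.
    have h2 : ∫ s in (0 : ℝ)..1, s * c n s ^ 2 =
        ((n : ℝ) ^ 3)⁻¹ * ∫ s in (0 : ℝ)..1, (n * s) * (deckZeros n ⌊n * s⌋₊ : ℝ) ^ 2 := by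
      rw [← intervalIntegral.integral_const_mul]
      refine intervalIntegral.integral_congr fun s _ => ?_
      simp only [hc]
      field_simp
    rw [h2, h, smul_eq_mul]
    generalize ∑ i ∈ Finset.range n, ((i : ℝ) + 1 / 2) * (deckZeros n i : ℝ) ^ 2 = S
    field_simp
  rw [e1, e2]
  field_simp

theorem tendsto_pow_div_choose :
    Tendsto (fun n : ℕ => (n : ℝ) ^ 4 / ((2 * n).choose 4 : ℝ)) atTop (𝓝 (3 / 2)) := by
  have h2n : Tendsto (fun n : ℕ => 2 * n) atTop atTop :=
    tendsto_id.const_mul_atTop' two_pos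
  have h := (isEquivalent_choose 4).comp_tendsto h2n
  have hne : ∀ᶠ n : ℕ in atTop, ((2 * n).choose 4 : ℝ) ≠ 0 := by
    filter_upwards [eventually_ge_atTop 2] with n hn
    exact_mod_cast (Nat.choose_pos (by omega)).ne'
  have h1 := (Asymptotics.isEquivalent_iff_tendsto_one hne).mp h.symm
  have h2 := h1.const_mul (3 / 2)
  rw [mul_one] at h2
  refine h2.congr fun n => ?_
  simp only [Pi.div_apply, Function.comp_apply, Nat.factorial]
  push_cast
  ring

/-! ### The limit of the deck maxima and the final statement -/

theorem finite_brbrProbabilities (n : ℕ) : (brbrProbabilities n).Finite := by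
  refine (Set.finite_range fun X : Fin (2 * n) → Bool => wordDensity word1010 X).subset ?_
  rintro p ⟨X, -, rfl⟩
  exact ⟨X, rfl⟩

theorem exists_tendsto_max_brbr :
    ∃ M : ℕ → ℝ, (∀ n, IsGreatest (brbrProbabilities n) (M n)) ∧
      Tendsto M atTop (𝓝 (3 / (4 * Real.exp 1 ^ 2))) := by
  have hex : ∀ n, ∃ m, IsGreatest (brbrProbabilities n) m := fun n => by
    obtain ⟨X, hX, -⟩ := exists_deck n
    exact (finite_brbrProbabilities n).isCompact.exists_isGreatest ⟨_, X, hX, rfl⟩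
  choose M hM using hex
  refine ⟨M, hM, ?_⟩
  have hlim : 3 / (4 * Real.exp 1 ^ 2) = Real.exp (-1) ^ 2 / 2 * (3 / 2) := by
    rw [Real.exp_neg]; field_simp; norm_num
  rw [hlim]
  -- Squeeze between the constructed decks and the bound `n ^ 4 * exp (-1) ^ 2 / 2`, valid for every
  -- deck with `n > 0`; both sides are divided by the binomial coefficient.
  refine tendsto_of_tendsto_of_tendsto_of_le_of_le'
    (tendsto_deck_quadratic.mul tendsto_pow_div_choose)
    (tendsto_const_nhds.mul tendsto_pow_div_choose) ?_ ?_
  · filter_upwards [eventually_gt_atTop 0] with n hn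
    have hn' : (n : ℝ) ≠ 0 := by exact_mod_cast hn.ne'
    obtain ⟨X, hX, hcount⟩ := exists_deck n
    have := (hM n).2 ⟨X, hX, rfl⟩
    rw [wordDensity, hcount] at this
    rw [div_mul_div_cancel₀ (pow_ne_zero 4 hn')]
    exact this
  · filter_upwards [eventually_gt_atTop 0] with n hn
    obtain ⟨X, hX, hMX⟩ := (hM n).1
    rw [hMX, wordDensity, ← mul_div_assoc]
    refine div_le_div_of_nonneg_right ?_ (Nat.cast_nonneg _)
    refine (patternCount_word1010_le hn X hX).trans_eq ?_
    ring

theorem mainTheorem3 :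
    (∀ ρ : ℝ, 0 ≤ ρ → ρ ≤ 1 →
      IsGreatest (patternDensity word1010 '' sublebesgueWithMass ρ)
        (12 / Real.exp 1 ^ 2 * ρ ^ 2 * (1 - ρ) ^ 2) ∧
      ∃ μ ∈ sublebesgueWithMass ρ,
        patternDensity word1010 μ = 12 / Real.exp 1 ^ 2 * ρ ^ 2 * (1 - ρ) ^ 2 ∧
        unitDensity μ =ᵐ[lebesgueUnit] optimalDensity ρ ∧
        ∀ ν ∈ sublebesgueWithMass ρ,
          patternDensity word1010 ν = 12 / Real.exp 1 ^ 2 * ρ ^ 2 * (1 - ρ) ^ 2 → ν = μ) ∧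
    ∃ M : ℕ → ℝ, (∀ n, IsGreatest (brbrProbabilities n) (M n)) ∧
      Tendsto M atTop (𝓝 (3 / (4 * Real.exp 1 ^ 2))) :=
  ⟨fun _ h0 h1 => exists_unique_optimal_sublebesgue h0 h1, exists_tendsto_max_brbr⟩
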